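/- Let $n\ge 1$ and let $\mathrm{SU}(n)\subset \mathrm{SU}(n+1)$ be embedded as the lower right hand $n\times n$ block, so that $S^{2n+1}=\mathrm{SU}(n+1)/\mathrm{SU}(n)$. Put $B_0(X,Y)=-\operatorname{Re}\operatorname{tr}(XY)$, let $\mathfrak m=\mathfrak{su}(n)^{\perp_{B_0}}\subset\mathfrak{su}(n+1)$, let $\mathfrak m_1=\mathbb R\,\xi$ with $\xi=\operatorname{diag}(-ni,i,\dots,i)$, and let $\mathfrak m_2$ be the $B_0$-orthogonal complement of $\mathfrak m_1$ in $\mathfrak m$. For $a,b>0$ let $g_{a,b}=aB_0|_{\mathfrak m_1}+bB_0|_{\mathfrak m_2}$ be the corresponding $\mathrm{SU}(n+1)$-invariant metric. Writing $E_{1,p+1}$ (resp. $F_{1,p+1}$) for the matrix with entry $1$ at $(p+1,1)$, entry $-1$ (resp. $1$) at $(1,p+1)$, and zeros elsewhere, fix the $g_{a,b}$-orthonormal basis $$e_1=\tfrac{1}{\sqrt{an(n+1)}}\,\xi,\qquad e_{2p}=\tfrac{1}{\sqrt{2b}}E_{1,p+1},\qquad e_{2p+1}=\tfrac{i}{\sqrt{2b}}F_{1,p+1}\qquad(1\le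 p\le n)$$ of $\mathfrak m$. In $\mathfrak m^{\mathbb C}$, with the complex bilinear extension of $g_{a,b}$, put $x_p=\tfrac1{\sqrt2}(e_{2p}-ie_{2p+1})$, $y_p=\tfrac1{\sqrt2}(e_{2p}+ie_{2p+1})$ and $L'=\operatorname{span}_{\mathbb C}\{y_1,\dots,y_n\}$. The spinor module is $\Sigma=\Lambda^\bullet L'$, with the Clifford multiplication (for the relation $X\cdot X=-g_{a,b}(X,X)$) $$e_{2p}\cdot\eta=i(x_p\lrcorner\eta+y_p\wedge\eta),\qquad e_{2p+1}\cdot\eta=y_p\wedge\eta-x_p\lrcorner\eta,\qquad e_1\cdot\eta=\pm i\,\eta\ \text{ on } \Lambda^{\mathrm{even}}/\Lambda^{\mathrm{odd}},$$ and $\sigma:\mathrm{Spin}(\mathfrak m)\to\mathrm{Aut}(\Sigma)$ is the resulting spin representation. Then the isotropy representation $\mathrm{Ad}:\mathrm{SU}(n)\to\mathrm{SO}(\mathfrak m)$ has a unique continuous lift $\widetilde{\mathrm{Ad}}:\mathrm{SU}(n)\to\mathrm{Spin}(\mathfrak m)$. Spinors on $(S^{2n+1}=\mathrm{SU}(n+1)/\mathrm{SU}(n),g_{a,b})$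 are the maps $\varphi:\mathrm{SU}(n+1)\to\Sigma$ with $\varphi(kh)=\sigma(\widetilde{\mathrm{Ad}}(h^{-1}))\varphi(k)$ for all $k\in \mathrm{SU}(n+1)$, $h\in\mathrm{SU}(n)$, and such a spinor is called invariant if $\varphi(k^{-1}k')=\varphi(k')$ for all $k,k'\in\mathrm{SU}(n+1)$. For all $a,b>0$, the invariant spinors are exactly the constant maps with value in $$\Sigma_{\mathrm{inv}}=\operatorname{span}_{\mathbb C}\{\psi_+=1,\ \psi_-=y_1\wedge\dots\wedge y_n\},$$ and they form a complex vector space of dimension $2$. -/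

import Mathlib

open scoped TensorProduct Matrix

noncomputable section

namespace HermitianSphere

/-! ### The groups `SU(n) ⊂ SU(n+1)` and the Lie algebras `su(n) ⊂ su(n+1)` -/

/-- The compact Lie group `SU(n)`. -/
abbrev SU (n : ℕ) : Type := Matrix.specialUnitaryGroup (Fin n) ℂ

/-- The block diagonal matrix `diag(z, A)`, with `A` in the lower right hand `n × n` block. -/
def blockDiag {n : ℕ} (z : ℂ) (A : Matrix (Fin n) (Fin n) ℂ) :
    Matrix (Fin (n + 1)) (Fin (n + 1)) ℂ :=
  Matrix.of (Fin.cons (Fin.cons z 0) fun i => Fin.cons 0 (A i))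

section blockDiag

variable {n : ℕ} (z w : ℂ) (A B : Matrix (Fin n) (Fin n) ℂ) (i j : Fin n)

@[simp] lemma blockDiag_zero_zero : blockDiag z A 0 0 = z := rfl
@[simp] lemma blockDiag_zero_succ : blockDiag z A 0 j.succ = 0 := rfl
@[simp] lemma blockDiag_succ_zero : blockDiag z A i.succ 0 = 0 := rfl
@[simp] lemma blockDiag_succ_succ : blockDiag z A i.succ j.succ = A i j := rfl

lemma blockDiag_one : blockDiag 1 (1 : Matrix (Fin n) (Fin n) ℂ) = 1 := by
  ext i j
  cases i using Fin.cases <;> cases j using Fin.cases <;>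
    simp [Matrix.one_apply, Fin.succ_ne_zero, (Fin.succ_ne_zero _).symm]

lemma blockDiag_mul : blockDiag z A * blockDiag w B = blockDiag (z * w) (A * B) := by
  ext i j
  cases i using Fin.cases <;> cases j using Fin.cases <;>
    simp [Matrix.mul_apply, Fin.sum_univ_succ]

lemma blockDiag_star : star (blockDiag z A) = blockDiag (star z) (star A) := by
  ext i j
  cases i using Fin.cases <;> cases j using Fin.cases <;> simp [Matrix.star_apply]

lemma blockDiag_det : (blockDiag z A).det = z * A.det := by
  rw [Matrix.det_succ_row_zero, Fin.sum_univ_succ]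
  have : (blockDiag z A).submatrix Fin.succ (Fin.succAbove 0) = A := by
    ext i j; simp [Matrix.submatrix_apply]
  rw [this]
  simp

end blockDiag

/-- The inclusion `SU(n) ↪ SU(n+1)` as the lower right hand block. -/
def incl (n : ℕ) : SU n →* SU (n + 1) where
  toFun h := ⟨blockDiag 1 h.1, by
    obtain ⟨h, hh⟩ := h
    rw [Matrix.mem_specialUnitaryGroup_iff, Matrix.mem_unitaryGroup_iff] at hh ⊢
    rw [blockDiag_star, blockDiag_mul, blockDiag_det, hh.1, hh.2]
    simp [blockDiag_one]⟩
  map_one' := Subtype.ext blockDiag_one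
  map_mul' h k := Subtype.ext (by simp [blockDiag_mul])

/-- The real Lie algebra `su(n)` of trace-free skew-Hermitian matrices. -/
def su (n : ℕ) : Submodule ℝ (Matrix (Fin n) (Fin n) ℂ) where
  carrier := {X | Xᴴ = -X ∧ X.trace = 0}
  add_mem' := by
    rintro X Y ⟨h₁, h₂⟩ ⟨h₃, h₄⟩
    exact ⟨by rw [Matrix.conjTranspose_add, h₁, h₃, neg_add], by simp [h₂, h₄]⟩
  zero_mem' := by simp
  smul_mem' := by
    rintro c X ⟨h₁, h₂⟩
    exact ⟨by rw [Matrix.conjTranspose_smul, h₁]; simp, by simp [h₂]⟩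

/-- The bilinear form `B₀(X, Y) = - Re tr (X Y)`. -/
def B₀ (n : ℕ) : LinearMap.BilinForm ℝ (Matrix (Fin n) (Fin n) ℂ) :=
  LinearMap.mk₂ ℝ (fun X Y => -((X * Y).trace).re)
    (by intros; simp [add_mul]; ring) (by intros; simp)
    (by intros; simp [mul_add]; ring) (by intros; simp)

lemma B₀_apply {n : ℕ} (X Y : Matrix (Fin n) (Fin n) ℂ) : B₀ n X Y = -((X * Y).trace).re := rfl

/-- The reductive complement `𝔪 = su(n)^⊥` in `su(n+1)`, with respect to `B₀`. -/
def 𝔪 (n : ℕ) : Submodule ℝ (Matrix (Fin (n + 1)) (Fin (n + 1)) ℂ) where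
  carrier := {X | X ∈ su (n + 1) ∧ ∀ Y ∈ su n, B₀ (n + 1) X (blockDiag 0 Y) = 0}
  add_mem' := by
    rintro X Y ⟨h₁, h₂⟩ ⟨h₃, h₄⟩
    exact ⟨add_mem h₁ h₃, fun Z hZ => by simp [h₂ Z hZ, h₄ Z hZ]⟩
  zero_mem' := ⟨zero_mem _, by simp⟩
  smul_mem' := by
    rintro c X ⟨h₁, h₂⟩
    exact ⟨Submodule.smul_mem _ _ h₁, fun Z hZ => by simp [h₂ Z hZ]⟩

/-! ### The isotropy representation `Ad|_H : H → GL(𝔪)` -/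

lemma conj_mem_su {n : ℕ} (g : SU n) {X : Matrix (Fin n) (Fin n) ℂ} (hX : X ∈ su n) :
    g.1 * X * star g.1 ∈ su n := by
  have hg := (Matrix.mem_specialUnitaryGroup_iff.1 g.2).1
  refine ⟨?_, ?_⟩
  · rw [Matrix.conjTranspose_mul, Matrix.conjTranspose_mul, hX.1]
    simp [Matrix.star_eq_conjTranspose, mul_assoc]
  · rw [Matrix.trace_mul_comm, ← mul_assoc, Matrix.mem_unitaryGroup_iff'.1 hg, one_mul]
    exact hX.2

lemma conj_mem_𝔪 {n : ℕ} (h : SU n) {X : Matrix (Fin (n + 1)) (Fin (n + 1)) ℂ} (hX : X ∈ 𝔪 n) :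
    (incl n h).1 * X * star (incl n h).1 ∈ 𝔪 n := by
  refine ⟨conj_mem_su _ hX.1, fun Y hY => ?_⟩
  have h1 : (h⁻¹).1 * Y * star (h⁻¹).1 ∈ su n := conj_mem_su h⁻¹ hY
  have h2 := hX.2 _ h1
  have h3 : blockDiag 0 ((h⁻¹).1 * Y * star (h⁻¹).1)
      = star (incl n h).1 * blockDiag 0 Y * (incl n h).1 := by
    have e1 : (incl n h).1 = blockDiag 1 h.1 := rfl
    have e2 : (h⁻¹).1 = star h.1 := rfl
    rw [e1, e2, blockDiag_star, blockDiag_mul, blockDiag_mul]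
    simp
  rw [h3, B₀_apply] at h2
  rw [B₀_apply, ← h2, Matrix.mul_assoc, Matrix.mul_assoc, Matrix.trace_mul_comm]
  simp only [Matrix.mul_assoc]

/-- The isotropy representation: `Ad(h) X = h X h⁻¹` for `h ∈ SU(n)` and `X ∈ 𝔪`. -/
def isotropy (n : ℕ) (h : SU n) : 𝔪 n →ₗ[ℝ] 𝔪 n where
  toFun X := ⟨(incl n h).1 * X.1 * star (incl n h).1, conj_mem_𝔪 h X.2⟩
  map_add' X Y := Subtype.ext (by simp [mul_add, add_mul])
  map_smul' c X := Subtype.ext (by simp)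

/-! ### The invariant metrics `g_{a,b}` and the adapted orthonormal basis -/

/-- The elementary skew-symmetric matrix `E_{1,p+1}` (entry `-1` at `(1,p+1)`, `1` at `(p+1,1)`). -/
def E (n : ℕ) (p : Fin n) : Matrix (Fin (n + 1)) (Fin (n + 1)) ℂ :=
  Matrix.single p.succ 0 1 - Matrix.single 0 p.succ 1

/-- The elementary symmetric matrix `F_{1,p+1}`. -/
def F (n : ℕ) (p : Fin n) : Matrix (Fin (n + 1)) (Fin (n + 1)) ℂ :=
  Matrix.single p.succ 0 1 + Matrix.single 0 p.succ 1

/-- The diagonal matrix `i (-n F_{1,1} + ∑_{l ≥ 2} F_{l,l})`, which spans the trivial summand `𝔪₁`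
of the isotropy representation. -/
def ξ (n : ℕ) : Matrix (Fin (n + 1)) (Fin (n + 1)) ℂ :=
  blockDiag (-(n : ℂ) * Complex.I) (Complex.I • 1)

/-- The `B₀`-orthogonal projection of `𝔪 = 𝔪₁ ⊕ 𝔪₂` onto `𝔪₁ = ℝ ξ`. -/
def pr₁ (n : ℕ) : 𝔪 n →ₗ[ℝ] Matrix (Fin (n + 1)) (Fin (n + 1)) ℂ :=
  ((B₀ (n + 1) (ξ n) (ξ n))⁻¹ • (B₀ (n + 1)).flip (ξ n) ∘ₗ (𝔪 n).subtype).smulRight (ξ n)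

/-- The `B₀`-orthogonal projection of `𝔪 = 𝔪₁ ⊕ 𝔪₂` onto the standard summand `𝔪₂`. -/
def pr₂ (n : ℕ) : 𝔪 n →ₗ[ℝ] Matrix (Fin (n + 1)) (Fin (n + 1)) ℂ := (𝔪 n).subtype - pr₁ n

/-- The invariant metric `g_{a,b} = a B₀|_{𝔪₁} + b B₀|_{𝔪₂}` on `𝔪`. -/
def g (n : ℕ) (a b : ℝ) : LinearMap.BilinForm ℝ (𝔪 n) :=
  a • (B₀ (n + 1)).compl₁₂ (pr₁ n) (pr₁ n) + b • (B₀ (n + 1)).compl₁₂ (pr₂ n) (pr₂ n)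

lemma B₀_comm {n : ℕ} (X Y : Matrix (Fin n) (Fin n) ℂ) : B₀ n X Y = B₀ n Y X := by
  rw [B₀_apply, B₀_apply, Matrix.trace_mul_comm]

lemma B₀_E {n : ℕ} (p : Fin n) (Y : Matrix (Fin (n + 1)) (Fin (n + 1)) ℂ) :
    B₀ (n + 1) (E n p) Y = (Y p.succ 0).re - (Y 0 p.succ).re := by
  simp [B₀_apply, E, Matrix.trace_single_mul, -neg_sub]
  ring

lemma B₀_F {n : ℕ} (p : Fin n) (Y : Matrix (Fin (n + 1)) (Fin (n + 1)) ℂ) :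
    B₀ (n + 1) (Complex.I • F n p) Y = (Y 0 p.succ).im + (Y p.succ 0).im := by
  simp [B₀_apply, F, Matrix.trace_single_mul]

lemma B₀_ξ {n : ℕ} (Y : Matrix (Fin (n + 1)) (Fin (n + 1)) ℂ) :
    B₀ (n + 1) (ξ n) Y = -n * (Y 0 0).im + ∑ p : Fin n, (Y p.succ p.succ).im := by
  simp [B₀_apply, ξ, Matrix.trace, Fin.sum_univ_succ, Matrix.mul_apply, Matrix.one_apply,
    Finset.sum_neg_distrib]
  ring

lemma ξ_mem (n : ℕ) : ξ n ∈ 𝔪 n := by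
  refine ⟨⟨?_, ?_⟩, fun Y hY => ?_⟩
  · ext i j
    cases i using Fin.cases <;> cases j using Fin.cases <;>
      simp [ξ, Matrix.conjTranspose_apply, Matrix.one_apply, eq_comm, apply_ite]
  · simp [ξ, Matrix.trace, Fin.sum_univ_succ]
  · rw [B₀_ξ]
    have := congrArg Complex.im hY.2
    simpa [Matrix.trace] using this

lemma E_mem (n : ℕ) (p : Fin n) : E n p ∈ 𝔪 n := by
  refine ⟨⟨?_, ?_⟩, fun Y hY => ?_⟩
  · simp [E, Matrix.conjTranspose_sub, Matrix.conjTranspose_single]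
  · simp [E, Matrix.trace_single_eq_of_ne, Fin.succ_ne_zero, (Fin.succ_ne_zero _).symm]
  · simp [B₀_E]

lemma F_mem (n : ℕ) (p : Fin n) : Complex.I • F n p ∈ 𝔪 n := by
  refine ⟨⟨?_, ?_⟩, fun Y hY => ?_⟩
  · simp [F, Matrix.conjTranspose_add, Matrix.conjTranspose_single, ← Matrix.single_neg]
  · simp [F, Matrix.trace_single_eq_of_ne, Fin.succ_ne_zero, (Fin.succ_ne_zero _).symm]
  · simp [B₀_F]

/-- The basis vector `e₁ = (a n (n+1))^{-1/2} ξ`. -/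
def e₁ (n : ℕ) (a : ℝ) : 𝔪 n := (√(a * n * (n + 1)))⁻¹ • ⟨ξ n, ξ_mem n⟩

/-- The basis vector `e_{2p} = (2b)^{-1/2} E_{1,p+1}`. -/
def eEven (n : ℕ) (b : ℝ) (p : Fin n) : 𝔪 n := (√(2 * b))⁻¹ • ⟨E n p, E_mem n p⟩

/-- The basis vector `e_{2p+1} = (2b)^{-1/2} i F_{1,p+1}`. -/
def eOdd (n : ℕ) (b : ℝ) (p : Fin n) : 𝔪 n := (√(2 * b))⁻¹ • ⟨Complex.I • F n p, F_mem n p⟩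

lemma scalar_block {n : ℕ} (hn : 1 ≤ n) {X : Matrix (Fin (n + 1)) (Fin (n + 1)) ℂ}
    (hX : X ∈ 𝔪 n) (p q : Fin n) :
    X p.succ q.succ = if p = q then -(X 0 0) / n else 0 := by
  obtain ⟨⟨h1, h2⟩, h3⟩ := hX
  have hn0 : (n : ℂ) ≠ 0 := by exact_mod_cast (by omega : n ≠ 0)
  have h1' : ∀ i j, star (X j i) = -X i j := fun i j => congrFun (congrFun h1 i) j
  set D : Matrix (Fin n) (Fin n) ℂ := X.submatrix Fin.succ Fin.succ with hD
  have htr : D.trace = -(X 0 0) := by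
    rw [Matrix.trace, Fin.sum_univ_succ] at h2
    simp only [Matrix.diag_apply] at h2
    simp only [Matrix.trace, Matrix.diag_apply, hD, Matrix.submatrix_apply]
    exact eq_neg_of_add_eq_zero_right h2
  set D0 : Matrix (Fin n) (Fin n) ℂ := D - (-(X 0 0) / n) • 1 with hD0
  have hD0su : D0 ∈ su n := by
    refine ⟨?_, ?_⟩
    · ext i j
      have := h1' i.succ j.succ
      have h00 := h1' 0 0
      simp only [hD0, hD, Matrix.conjTranspose_apply, Matrix.sub_apply, Matrix.submatrix_apply,
        Matrix.smul_apply, Matrix.neg_apply, star_sub, this, Matrix.one_apply, smul_eq_mul,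
        star_mul', star_div₀, star_neg, h00]
      by_cases hij : i = j
      · subst hij; simp; ring
      · simp [hij, Ne.symm hij]
    · rw [hD0, Matrix.trace_sub, htr, Matrix.trace_smul, Matrix.trace_one]
      simp [hn0]
  have h4 := h3 D0 hD0su
  have h5 : (X * blockDiag 0 D0).trace = (D0 * D0).trace := by
    have : (X * blockDiag 0 D0).trace = (D * D0).trace := by
      simp [Matrix.trace, Fin.sum_univ_succ, Matrix.mul_apply, hD]
    rw [this]
    conv_rhs => rw [hD0, sub_mul]
    rw [← hD0, Matrix.trace_sub]
    simp [hD0su.2]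
  have h6 : ((D0ᴴ * D0).trace).re = 0 := by
    rw [B₀_apply, h5] at h4
    rw [hD0su.1]
    simpa using h4
  have h7 : ∑ i, ∑ j, Complex.normSq (D0 j i) = 0 := by
    rw [← h6]
    simp [Matrix.trace, Matrix.mul_apply, Complex.normSq_apply]
  have h8 : D0 p q = 0 := by
    rw [Finset.sum_eq_zero_iff_of_nonneg
      (fun i _ => Finset.sum_nonneg fun j _ => Complex.normSq_nonneg _)] at h7
    have := h7 q (Finset.mem_univ _)
    rw [Finset.sum_eq_zero_iff_of_nonneg (fun j _ => Complex.normSq_nonneg _)] at this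
    exact Complex.normSq_eq_zero.1 (this p (Finset.mem_univ _))
  have h9 : D p q = (-(X 0 0) / n) * (1 : Matrix (Fin n) (Fin n) ℂ) p q := by
    rw [hD0, Matrix.sub_apply, sub_eq_zero] at h8
    simpa using h8
  simpa [hD, Matrix.one_apply] using h9

lemma g_apply (n : ℕ) (a b : ℝ) (X Y : 𝔪 n) :
    g n a b X Y = a * B₀ (n + 1) (pr₁ n X) (pr₁ n Y) + b * B₀ (n + 1) (pr₂ n X) (pr₂ n Y) := rfl

lemma pr₁_apply (n : ℕ) (X : 𝔪 n) :
    pr₁ n X = ((B₀ (n + 1) (ξ n) (ξ n))⁻¹ * B₀ (n + 1) (ξ n) X) • ξ n := by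
  rw [B₀_comm (ξ n) X]; rfl

lemma pr₂_apply (n : ℕ) (X : 𝔪 n) : pr₂ n X = X.1 - pr₁ n X := rfl

lemma B₀_ξ_ξ (n : ℕ) : B₀ (n + 1) (ξ n) (ξ n) = n * (n + 1) := by
  rw [B₀_ξ]; simp [ξ]; ring

lemma 𝔪_re {n : ℕ} (X : 𝔪 n) (i j : Fin (n + 1)) : (X.1 j i).re = -(X.1 i j).re :=
  congrArg Complex.re (congrFun (congrFun X.2.1.1 i) j)

lemma 𝔪_im {n : ℕ} (X : 𝔪 n) (i j : Fin (n + 1)) : (X.1 j i).im = (X.1 i j).im := by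
  have := congrArg Complex.im (congrFun (congrFun X.2.1.1 i) j)
  simpa using this

lemma g_eEven {n : ℕ} (a b : ℝ) (X : 𝔪 n) (p : Fin n) :
    g n a b X (eEven n b p) = b * ((√(2 * b))⁻¹ * (2 * (X.1 p.succ 0).re)) := by
  have hpE : pr₁ n ⟨E n p, E_mem n p⟩ = 0 := by
    rw [pr₁_apply, B₀_comm (ξ n) (E n p), B₀_E]; simp [ξ]
  rw [g_apply, pr₂_apply n (eEven n b p), eEven, map_smul, hpE, pr₂_apply, pr₁_apply]
  simp only [smul_zero, map_zero, mul_zero, zero_add, sub_zero, Submodule.coe_smul, map_smul,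
    smul_eq_mul]
  rw [B₀_comm _ (E n p), B₀_E, Matrix.sub_apply, Matrix.sub_apply, Complex.sub_re, Complex.sub_re,
    𝔪_re X p.succ 0]
  have h1 : ξ n p.succ 0 = 0 := rfl
  have h2 : ξ n 0 p.succ = 0 := rfl
  simp only [Matrix.smul_apply, h1, h2, smul_zero, Complex.zero_re]
  ring

lemma g_eOdd {n : ℕ} (a b : ℝ) (X : 𝔪 n) (p : Fin n) :
    g n a b X (eOdd n b p) = b * ((√(2 * b))⁻¹ * (2 * (X.1 p.succ 0).im)) := by
  have hpF : pr₁ n ⟨Complex.I • F n p, F_mem n p⟩ = 0 := by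
    rw [pr₁_apply, B₀_comm (ξ n) (Complex.I • F n p), B₀_F]; simp [ξ]
  rw [g_apply, pr₂_apply n (eOdd n b p), eOdd, map_smul, hpF, pr₂_apply, pr₁_apply]
  simp only [smul_zero, map_zero, mul_zero, zero_add, sub_zero, Submodule.coe_smul, map_smul,
    smul_eq_mul]
  rw [B₀_comm _ (Complex.I • F n p), B₀_F, Matrix.sub_apply, Matrix.sub_apply, Complex.sub_im,
    Complex.sub_im, 𝔪_im X p.succ 0]
  have h1 : ξ n p.succ 0 = 0 := rfl
  have h2 : ξ n 0 p.succ = 0 := rfl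
  simp only [Matrix.smul_apply, h1, h2, smul_zero, Complex.zero_im]
  ring

/-- Parseval's identity: `e₁, …, e_{2n+1}` is a `g_{a,b}`-orthonormal basis of `𝔪`. -/
lemma g_self {n : ℕ} (hn : 1 ≤ n) {a b : ℝ} (ha : 0 < a) (hb : 0 < b) (X : 𝔪 n) :
    g n a b X X = g n a b X (e₁ n a) ^ 2 +
      ∑ p, (g n a b X (eEven n b p) ^ 2 + g n a b X (eOdd n b p) ^ 2) := by
  have hn0 : (0 : ℝ) < n := by exact_mod_cast hn
  have hn1 : (0 : ℝ) < n * (n + 1) := by positivity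
  have hX := X.2
  have h1' : ∀ i j, star (X.1 j i) = -X.1 i j := fun i j => congrFun (congrFun hX.1.1 i) j
  have hre : ∀ i j, (X.1 j i).re = -(X.1 i j).re := fun i j => congrArg Complex.re (h1' i j)
  have him : ∀ i j, (X.1 j i).im = (X.1 i j).im := fun i j => by
    have := congrArg Complex.im (h1' i j)
    simpa using this
  have h00 : (X.1 0 0).re = 0 := by have := hre 0 0; linarith
  have hdiag : ∀ p : Fin n, (X.1 p.succ p.succ).im = -(X.1 0 0).im / n := by
    intro p
    rw [scalar_block hn hX p p, if_pos rfl]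
    rw [← Complex.ofReal_natCast, Complex.div_ofReal_im, Complex.neg_im]
  have hs : pr₁ n X = (-(X.1 0 0).im / n) • ξ n := by
    rw [pr₁_apply, B₀_ξ_ξ, B₀_ξ]
    simp only [hdiag]
    congr 1
    simp only [Finset.sum_const, Finset.card_univ, Fintype.card_fin, nsmul_eq_mul]
    field_simp
    ring
  set s : ℝ := -(X.1 0 0).im / n with hsdef
  have hpξ : pr₁ n ⟨ξ n, ξ_mem n⟩ = ξ n := by
    rw [pr₁_apply, B₀_ξ_ξ, inv_mul_cancel₀ hn1.ne', one_smul]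
  have hg1 : g n a b X (e₁ n a) = a * (s * ((√(a * n * (n + 1)))⁻¹ * (n * (n + 1)))) := by
    rw [g_apply, pr₂_apply n (e₁ n a), e₁, map_smul, hpξ, hs]
    simp only [map_smul, LinearMap.smul_apply, B₀_ξ_ξ, smul_eq_mul, Submodule.coe_smul, sub_self,
      map_zero, mul_zero, add_zero]
    ring
  have hgE := fun p => g_eEven a b X p
  have hgF := fun p => g_eOdd a b X p
  have hZ00 : (pr₂ n X) 0 0 = 0 := by
    rw [pr₂_apply, hs]
    apply Complex.ext
    · simp [ξ, h00]
    · simp [ξ, hsdef]; field_simp; ring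
  have hZpq : ∀ p q : Fin n, (pr₂ n X) p.succ q.succ = 0 := by
    intro p q
    rw [pr₂_apply, hs, Matrix.sub_apply, scalar_block hn hX p q]
    by_cases hpq : p = q
    · subst hpq
      rw [if_pos rfl, ← Complex.ofReal_natCast]
      apply Complex.ext
      · rw [Complex.sub_re, Complex.div_ofReal_re]
        simp [ξ, h00]
      · rw [Complex.sub_im, Complex.div_ofReal_im]
        simp [ξ, hsdef]
    · simp [hpq, ξ]
  have hZp0 : ∀ p : Fin n, (pr₂ n X) p.succ 0 = X.1 p.succ 0 := by
    intro p; rw [pr₂_apply, hs]; simp [ξ]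
  have hZ0p : ∀ p : Fin n, (pr₂ n X) 0 p.succ = X.1 0 p.succ := by
    intro p; rw [pr₂_apply, hs]; simp [ξ]
  have hZZ : B₀ (n + 1) (pr₂ n X) (pr₂ n X)
      = ∑ p : Fin n, 2 * ((X.1 p.succ 0).re ^ 2 + (X.1 p.succ 0).im ^ 2) := by
    rw [B₀_apply]
    simp only [Matrix.trace, Matrix.diag_apply, Matrix.mul_apply, Fin.sum_univ_succ, hZ00, hZpq,
      hZp0, hZ0p, mul_zero, zero_add, Finset.sum_const_zero, add_zero]
    rw [← Finset.sum_add_distrib, Complex.re_sum, ← Finset.sum_neg_distrib]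
    refine Finset.sum_congr rfl fun p _ => ?_
    simp only [Complex.add_re, Complex.mul_re, hre p.succ 0, him p.succ 0]
    ring
  have hsq1 : (√(a * n * (n + 1)))⁻¹ ^ 2 = (a * n * (n + 1))⁻¹ := by
    rw [inv_pow, Real.sq_sqrt (by positivity)]
  have hsq2 : (√(2 * b))⁻¹ ^ 2 = (2 * b)⁻¹ := by
    rw [inv_pow, Real.sq_sqrt (by positivity)]
  rw [hg1, g_apply, hZZ, hs]
  simp only [hgE, hgF, mul_pow, hsq1, hsq2, map_smul, LinearMap.smul_apply, B₀_ξ_ξ, smul_eq_mul,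
    Finset.mul_sum]
  congr 1
  · field_simp
  · refine Finset.sum_congr rfl fun p _ => ?_
    field_simp

/-! ### The complexification `𝔪^ℂ`, the Lagrangian `L'` and the spinor module `Σ = Λ^• L'` -/

/-- The complex bilinear extension `β` of `g_{a,b}` to `𝔪^ℂ = ℂ ⊗ 𝔪`. -/
def β (n : ℕ) (a b : ℝ) : LinearMap.BilinForm ℂ (ℂ ⊗[ℝ] 𝔪 n) :=
  LinearMap.BilinForm.baseChange ℂ (g n a b)

/-- `x_p = (e_{2p} - i e_{2p+1}) / √2`. -/
def x (n : ℕ) (b : ℝ) (p : Fin n) : ℂ ⊗[ℝ] 𝔪 n :=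
  (1 / (√2 : ℂ)) • (1 ⊗ₜ eEven n b p - Complex.I ⊗ₜ eOdd n b p)

/-- `y_p = (e_{2p} + i e_{2p+1}) / √2`. -/
def y₀ (n : ℕ) (b : ℝ) (p : Fin n) : ℂ ⊗[ℝ] 𝔪 n :=
  (1 / (√2 : ℂ)) • (1 ⊗ₜ eEven n b p + Complex.I ⊗ₜ eOdd n b p)

/-- The Lagrangian subspace `L' = span_ℂ {y₁, …, y_n}` of `𝔪^ℂ`. -/
def L' (n : ℕ) (b : ℝ) : Submodule ℂ (ℂ ⊗[ℝ] 𝔪 n) := Submodule.span ℂ (Set.range (y₀ n b))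

/-- `y_p` as an element of `L'`. -/
def y (n : ℕ) (b : ℝ) (p : Fin n) : L' n b := ⟨y₀ n b p, Submodule.subset_span ⟨p, rfl⟩⟩

/-- The spinor module `Σ = Λ^• L'`. -/
abbrev Spinor (n : ℕ) (b : ℝ) : Type := ExteriorAlgebra ℂ (L' n b)

/-- Exterior multiplication `η ↦ y_p ∧ η`. -/
def wedge (n : ℕ) (b : ℝ) (p : Fin n) : Module.End ℂ (Spinor n b) :=
  LinearMap.mulLeft ℂ (ExteriorAlgebra.ι ℂ (y n b p))

/-- Interior multiplication `η ↦ x_p ⌟ η`, where `x_p` acts on `L'` as the functional `β(x_p, ·)`. -/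
def contract (n : ℕ) (a b : ℝ) (p : Fin n) : Module.End ℂ (Spinor n b) :=
  CliffordAlgebra.contractLeft (β n a b (x n b p) ∘ₗ (L' n b).subtype)

/-- The parity operator: the identity on `Σ^even` and minus the identity on `Σ^odd`. -/
def parity (n : ℕ) (b : ℝ) : Module.End ℂ (Spinor n b) :=
  (CliffordAlgebra.involute (Q := (0 : QuadraticForm ℂ (L' n b)))).toLinearMap

/-- Clifford multiplication by `e₁ = -i u₀`: `i` on `Σ^even` and `-i` on `Σ^odd`. -/
def c₁ (n : ℕ) (b : ℝ) : Module.End ℂ (Spinor n b) := Complex.I • parity n b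

/-- Clifford multiplication by `e_{2p}`: `η ↦ i (x_p ⌟ η + y_p ∧ η)`. -/
def cEven (n : ℕ) (a b : ℝ) (p : Fin n) : Module.End ℂ (Spinor n b) :=
  Complex.I • (contract n a b p + wedge n b p)

/-- Clifford multiplication by `e_{2p+1}`: `η ↦ y_p ∧ η - x_p ⌟ η`. -/
def cOdd (n : ℕ) (a b : ℝ) (p : Fin n) : Module.End ℂ (Spinor n b) :=
  wedge n b p - contract n a b p

/-- Clifford multiplication `𝔪 → End_ℂ(Σ)`, extended linearly from the orthonormal basis `e_i`. -/
def cliffordMul (n : ℕ) (a b : ℝ) : 𝔪 n →ₗ[ℝ] Module.End ℂ (Spinor n b) :=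
  ((g n a b).flip (e₁ n a)).smulRight (c₁ n b) +
    ∑ p, (((g n a b).flip (eEven n b p)).smulRight (cEven n a b p) +
      ((g n a b).flip (eOdd n b p)).smulRight (cOdd n a b p))

/-- The quadratic form `X ↦ -g_{a,b}(X, X)`, so that `X · X = -g_{a,b}(X, X)` in the Clifford
algebra. -/
def Q (n : ℕ) (a b : ℝ) : QuadraticForm ℝ (𝔪 n) := -(g n a b).toQuadraticMap

lemma β_x_y (n : ℕ) (a : ℝ) {b : ℝ} (hb : 0 < b) (p q : Fin n) :
    β n a b (x n b p) (y₀ n b q) = if p = q then 1 else 0 := by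
  have hsq : (√(2 * b))⁻¹ * (√(2 * b))⁻¹ = (2 * b)⁻¹ := by
    rw [← mul_inv, Real.mul_self_sqrt (by positivity)]
  have h2 : ((√2 : ℂ))⁻¹ * ((√2 : ℂ))⁻¹ = 1 / 2 := by
    rw [← mul_inv, ← Complex.ofReal_mul, Real.mul_self_sqrt (by norm_num)]; norm_num
  have hEE : g n a b (eEven n b p) (eEven n b q) = if p = q then 1 else 0 := by
    rw [g_eEven]
    by_cases hpq : p = q
    · subst hpq
      have : (eEven n b p).1 p.succ 0 = ((√(2 * b))⁻¹ : ℝ) := by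
        simp [eEven, E]
      rw [if_pos rfl, this, Complex.ofReal_re,
        show b * ((√(2 * b))⁻¹ * (2 * (√(2 * b))⁻¹)) = 2 * b * ((√(2 * b))⁻¹ * (√(2 * b))⁻¹) by ring,
        hsq, mul_inv_cancel₀ (by positivity)]
    · simp [eEven, E, hpq]
  have hOO : g n a b (eOdd n b p) (eOdd n b q) = if p = q then 1 else 0 := by
    rw [g_eOdd]
    by_cases hpq : p = q
    · subst hpq
      have : (eOdd n b p).1 p.succ 0 = Complex.I * ((√(2 * b))⁻¹ : ℝ) := by
        simp [eOdd, F]; ring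
      rw [if_pos rfl, this, Complex.I_mul_im, Complex.ofReal_re,
        show b * ((√(2 * b))⁻¹ * (2 * (√(2 * b))⁻¹)) = 2 * b * ((√(2 * b))⁻¹ * (√(2 * b))⁻¹) by ring,
        hsq, mul_inv_cancel₀ (by positivity)]
    · simp [eOdd, F, hpq]
  have hEO : g n a b (eEven n b p) (eOdd n b q) = 0 := by
    rw [g_eOdd]
    by_cases hpq : p = q
    · subst hpq; simp [eEven, E]
    · simp [eEven, E, hpq]
  have hOE : g n a b (eOdd n b p) (eEven n b q) = 0 := by
    rw [g_eEven]
    by_cases hpq : p = q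
    · subst hpq; simp [eOdd, F]
    · simp [eOdd, F, hpq]
  simp only [β, x, y₀, map_smul, LinearMap.smul_apply, map_sub, map_add, LinearMap.sub_apply,
    LinearMap.BilinForm.baseChange_tmul, hEE, hOO, hEO, hOE, smul_eq_mul, one_div]
  rw [← mul_add, ← mul_assoc, h2]
  by_cases hpq : p = q
  · simp [hpq]; norm_num
  · simp [hpq]

lemma fock_sq {M : Type*} [AddCommGroup M] [Module ℂ M] (d : Module.Dual ℂ M) (w : M) (z : ℂ)
    (T : Module.End ℂ (ExteriorAlgebra ℂ M))
    (hT : ∀ η, T η = z • CliffordAlgebra.involute (Q := (0 : QuadraticForm ℂ M)) η +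
      (CliffordAlgebra.contractLeft (Q := (0 : QuadraticForm ℂ M)) d η + ExteriorAlgebra.ι ℂ w * η))
    (η : ExteriorAlgebra ℂ M) : T (T η) = (z ^ 2 + d w) • η := by
  have hci : ∀ η : CliffordAlgebra (0 : QuadraticForm ℂ M),
      CliffordAlgebra.contractLeft d (CliffordAlgebra.involute η) =
        -CliffordAlgebra.involute (CliffordAlgebra.contractLeft d η) := by
    intro η
    induction η using CliffordAlgebra.left_induction with
    | algebraMap r => simp
    | add x y hx hy => simp only [map_add, hx, hy, neg_add]
    | ι_mul x m hx =>
      simp only [map_mul, CliffordAlgebra.involute_ι, neg_mul, map_neg,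
        CliffordAlgebra.contractLeft_ι_mul, hx, map_sub, map_smul]
      simp
  have hcc := CliffordAlgebra.contractLeft_contractLeft d (Q := (0 : QuadraticForm ℂ M)) η
  have hcw : CliffordAlgebra.contractLeft (Q := (0 : QuadraticForm ℂ M)) d
      (ExteriorAlgebra.ι ℂ w * η) = d w • η - ExteriorAlgebra.ι ℂ w *
        CliffordAlgebra.contractLeft (Q := (0 : QuadraticForm ℂ M)) d η :=
    CliffordAlgebra.contractLeft_ι_mul d w η
  have hiw : CliffordAlgebra.involute (Q := (0 : QuadraticForm ℂ M)) (ExteriorAlgebra.ι ℂ w) =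
      -ExteriorAlgebra.ι ℂ w := CliffordAlgebra.involute_ι w
  have hww : ExteriorAlgebra.ι ℂ w * (ExteriorAlgebra.ι ℂ w * η) = 0 := by
    rw [← mul_assoc, ExteriorAlgebra.ι_sq_zero, zero_mul]
  have hii : CliffordAlgebra.involute (Q := (0 : QuadraticForm ℂ M))
      (CliffordAlgebra.involute η) = η := CliffordAlgebra.involute_involute η
  rw [hT (T η), hT η]
  simp only [map_add, map_smul, map_mul, hci, hcc, hcw, hiw, hww, hii, mul_add, mul_smul_comm]
  simp only [smul_add, smul_neg, neg_mul, smul_smul, add_smul, pow_two]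
  abel

lemma fock_sum {M : Type*} [AddCommGroup M] [Module ℂ M] {n : ℕ} (d : Fin n → Module.Dual ℂ M)
    (w : Fin n → M) (t : ℂ) (u v : Fin n → ℂ) (η : ExteriorAlgebra ℂ M) :
    t • Complex.I • CliffordAlgebra.involute (Q := (0 : QuadraticForm ℂ M)) η +
      ∑ p, (u p • Complex.I • (CliffordAlgebra.contractLeft (Q := (0 : QuadraticForm ℂ M)) (d p) η +
          ExteriorAlgebra.ι ℂ (w p) * η) +
        v p • (ExteriorAlgebra.ι ℂ (w p) * η -
          CliffordAlgebra.contractLeft (Q := (0 : QuadraticForm ℂ M)) (d p) η)) =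
    (Complex.I * t) • CliffordAlgebra.involute (Q := (0 : QuadraticForm ℂ M)) η +
      (CliffordAlgebra.contractLeft (Q := (0 : QuadraticForm ℂ M))
        (∑ p, (Complex.I * u p - v p) • d p) η +
          ExteriorAlgebra.ι ℂ (∑ p, (Complex.I * u p + v p) • w p) * η) := by
  simp only [map_sum, map_smul, LinearMap.sum_apply, LinearMap.smul_apply, Finset.sum_mul,
    smul_mul_assoc]
  rw [← Finset.sum_add_distrib, smul_smul, mul_comm t]
  congr 1
  refine Finset.sum_congr rfl fun p _ => ?_
  generalize ExteriorAlgebra.ι ℂ (w p) * η = A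
  generalize CliffordAlgebra.contractLeft (Q := (0 : QuadraticForm ℂ M)) (d p) η = B
  module

lemma cliffordMul_apply (n : ℕ) (a b : ℝ) (X : 𝔪 n) (η : Spinor n b) :
    cliffordMul n a b X η =
      (g n a b X (e₁ n a) : ℂ) • c₁ n b η + ∑ p, ((g n a b X (eEven n b p) : ℂ) • cEven n a b p η +
        (g n a b X (eOdd n b p) : ℂ) • cOdd n a b p η) := by
  have hsm : ∀ (r : ℝ) (T : Module.End ℂ (Spinor n b)), (r • T) η = (r : ℂ) • T η := fun r T => by
    rw [LinearMap.smul_apply]; exact (Complex.coe_smul r (T η)).symm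
  have h0 : cliffordMul n a b X = g n a b X (e₁ n a) • c₁ n b +
      ∑ p, (g n a b X (eEven n b p) • cEven n a b p + g n a b X (eOdd n b p) • cOdd n a b p) := by
    simp [cliffordMul]
  rw [h0, LinearMap.add_apply, LinearMap.sum_apply, hsm]
  simp only [LinearMap.add_apply, hsm]

/-- The Clifford relation `X · X · η = -g_{a,b}(X, X) η`. -/
lemma cliffordMul_sq {n : ℕ} (hn : 1 ≤ n) {a b : ℝ} (ha : 0 < a) (hb : 0 < b) (X : 𝔪 n) :
    cliffordMul n a b X * cliffordMul n a b X = algebraMap ℝ _ (Q n a b X) := by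
  refine LinearMap.ext fun η => ?_
  have h1 : Q n a b X = -g n a b X X := rfl
  have h2 := fun η => (cliffordMul_apply n a b X η).trans
    (fock_sum (fun p => β n a b (x n b p) ∘ₗ (L' n b).subtype) (y n b) _ _ _ η)
  rw [Module.End.mul_apply, fock_sq _ _ _ _ h2, Module.algebraMap_end_apply,
    ← Complex.coe_smul (Q n a b X) η]
  congr 1
  have h3 : ∀ p q, (β n a b (x n b p) ∘ₗ (L' n b).subtype) (y n b q) = if p = q then 1 else 0 :=
    fun p q => β_x_y n a hb p q
  rw [h1, g_self hn ha hb X, map_sum, mul_pow, Complex.I_sq]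
  simp only [LinearMap.sum_apply, LinearMap.smul_apply, map_smul, h3, smul_eq_mul, mul_ite, mul_one,
    mul_zero, Finset.sum_ite_eq', Finset.mem_univ, if_true]
  push_cast
  rw [neg_add, ← Finset.sum_neg_distrib]
  congr 1
  · ring
  · refine Finset.sum_congr rfl fun p _ => ?_
    ring_nf
    rw [Complex.I_sq]
    ring

/-- The irreducible representation of the Clifford algebra of `(𝔪, g_{a,b})` on `Σ`. Its
restriction to `Spin(𝔪)` is the spin representation `σ`. -/
def cliffordRep {n : ℕ} (hn : 1 ≤ n) {a b : ℝ} (ha : 0 < a) (hb : 0 < b) :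
    CliffordAlgebra (Q n a b) →ₐ[ℝ] Module.End ℂ (Spinor n b) :=
  CliffordAlgebra.lift (Q n a b) ⟨cliffordMul n a b, cliffordMul_sq hn ha hb⟩

/-! ### The spin lift of the isotropy representation and the spinors -/

/-- The Clifford algebra of `𝔪` carries its topology as a finite-dimensional real vector space. -/
instance (n : ℕ) (a b : ℝ) : TopologicalSpace (CliffordAlgebra (Q n a b)) :=
  moduleTopology ℝ (CliffordAlgebra (Q n a b))

/-- The compact group `Spin(𝔪)` of `(𝔪, g_{a,b})`. -/
abbrev Spin (n : ℕ) (a b : ℝ) : Type := spinGroup (Q n a b)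

/-- `ρ : SU(n) → Spin(𝔪)` is a lift of the isotropy representation `Ad|_H : SU(n) → SO(𝔪)`: a
continuous homomorphism whose composition with the double cover `Spin(𝔪) → SO(𝔪)`,
`s ↦ (X ↦ s X s⁻¹)`, is `Ad|_H`. -/
structure IsSpinLift {n : ℕ} {a b : ℝ} (ρ : SU n →* Spin n a b) : Prop where
  continuous : Continuous ρ
  covers : ∀ (h : SU n) (X : 𝔪 n),
    (ρ h : CliffordAlgebra (Q n a b)) * CliffordAlgebra.ι (Q n a b) X *
      (((ρ h)⁻¹ : Spin n a b) : CliffordAlgebra (Q n a b)) =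
        CliffordAlgebra.ι (Q n a b) (isotropy n h X)

/-- The spinors on `SU(n+1)/SU(n)`, i.e. the sections of the bundle associated with `σ ∘ ρ`, viewed
as the `SU(n)`-equivariant maps `φ : SU(n+1) → Σ`, `φ(g h) = σ(ρ(h⁻¹)) φ(g)`. -/
def spinors {n : ℕ} (hn : 1 ≤ n) {a b : ℝ} (ha : 0 < a) (hb : 0 < b) (ρ : SU n →* Spin n a b) :
    Submodule ℂ (SU (n + 1) → Spinor n b) where
  carrier := {φ | ∀ (k : SU (n + 1)) (h : SU n),
    φ (k * incl n h) = cliffordRep hn ha hb (ρ h⁻¹ : CliffordAlgebra (Q n a b)) (φ k)}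
  add_mem' h₁ h₂ k h := by simp [h₁ k h, h₂ k h]
  zero_mem' k h := by simp
  smul_mem' c φ h₁ k h := by simp [h₁ k h]

/-- The space `Σ_inv` of invariant spinors: those fixed by the action
`(k · φ)(k') = φ(k⁻¹ k')` of `SU(n+1)`. (Such spinors are constant maps, in particular smooth.) -/
def invariantSpinors {n : ℕ} (hn : 1 ≤ n) {a b : ℝ} (ha : 0 < a) (hb : 0 < b)
    (ρ : SU n →* Spin n a b) : Submodule ℂ (SU (n + 1) → Spinor n b) where
  carrier := {φ | φ ∈ spinors hn ha hb ρ ∧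
    ∀ k : SU (n + 1), (fun k' => φ (k⁻¹ * k')) = φ}
  add_mem' := by
    rintro φ ψ ⟨h₁, h₂⟩ ⟨h₃, h₄⟩
    exact ⟨add_mem h₁ h₃, fun k => funext fun k' => by
      simp [congrFun (h₂ k) k', congrFun (h₄ k) k']⟩
  zero_mem' := ⟨zero_mem _, fun k => rfl⟩
  smul_mem' := by
    rintro c φ ⟨h₁, h₂⟩
    exact ⟨Submodule.smul_mem _ _ h₁, fun k => funext fun k' => by
      simp [congrFun (h₂ k) k']⟩

/-- The spinor `ψ₊ = 1`. -/
def ψplus (n : ℕ) (b : ℝ) : Spinor n b := 1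

/-- The spinor `ψ₋ = y₁ ∧ ⋯ ∧ y_n`. -/
def ψminus (n : ℕ) (b : ℝ) : Spinor n b := ExteriorAlgebra.ιMulti ℂ n (y n b)

end HermitianSphere

end

/-! Everything rests on one explicit action of `SU(n)` on `Σ = Λ^• L'`. Clifford multiplication by
`X ∈ 𝔪` is a Fock operator (a multiple of parity, plus a contraction, plus an exterior
multiplication) in which the functional depends complex linearly, and the vector antilinearly, on
the first column of `X` below the diagonal (`cliffordMul_eq`). The isotropy action of `h` multiplies
this column by `h` and fixes the `e₁`-component. Hence the operator `Λ` of `h`, induced by the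
entrywise conjugate of `h` on `L'`, intertwines Clifford multiplication by `X` and by `Ad(h) X`
(`Λ_cliffordMul`).

It remains to see that these operators come from `Spin(𝔪)`. The Clifford product of two unit vectors
of `𝔪₂` on the same complex line acts as `e^{iθ/2}` times the operator of a unitary quasi-reflection
of angle `θ` (`exists_spin_quasiReflection`). An element of `SU(n)` is a product of
quasi-reflections along an eigenbasis, with angles of sum zero, so the phases cancel
(`exists_map_eq_of_SU`). The Clifford module is faithful on even elements
(`eq_zero_of_map_eq_zero`), so the spin element over each `h` is unique. This faithfulness yields
the homomorphism, the covering property and continuity. Two lifts differ at `k` by an even element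
commuting with all vectors, hence by a scalar of square one; as every element of `SU(n)` is a
square, the lifts agree (`lift_unique`).

A translation-invariant spinor is constant, and equivariance says that its value is fixed by
`SU(n)`. Diagonal matrices with exactly two entries `-1` rule out every basis element of `Λ^• L'`
outside the bottom and top degrees; conversely `1` is fixed, and the top form is multiplied by the
conjugate of `det h = 1` (`forall_Λ_eq_iff`). -/

noncomputable section

namespace HermitianSphere

/-! ### Contractions in Clifford and exterior algebras -/

section Contraction

open CliffordAlgebra

variable {R M N : Type*} [Field R] [AddCommGroup M] [Module R M] [AddCommGroup N] [Module R N]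

/-- Euler's identity `∑ e_i ∧ (e^i ⌟ x) = k x` for `x ∈ Λ^k M`. -/
lemma sum_ι_mul_contractLeft {I : Type*} [Fintype I] (e : Module.Basis I R M) {k : ℕ}
    {x : ExteriorAlgebra R M} (hx : x ∈ ⋀[R]^k M) :
    ∑ i, ExteriorAlgebra.ι R (e i) * contractLeft (Q := (0 : QuadraticForm R M)) (e.coord i) x
      = (k : R) • x := by
  change x ∈ (LinearMap.range (ExteriorAlgebra.ι R : M →ₗ[R] _)) ^ k at hx
  induction hx using Submodule.pow_induction_on_left' with
  | algebraMap r =>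
    have h : ∀ i, contractLeft (Q := (0 : QuadraticForm R M)) (e.coord i)
        (algebraMap R (ExteriorAlgebra R M) r) = 0 := fun i => contractLeft_algebraMap _ _ _
    simp [h]
  | add x y i hx hy ihx ihy =>
    simp only [map_add, mul_add, Finset.sum_add_distrib, smul_add]
    rw [ihx, ihy]
  | mem_mul m hm i x hx ih =>
    obtain ⟨a, rfl⟩ := hm
    have h1 : ∀ i, contractLeft (Q := (0 : QuadraticForm R M)) (e.coord i)
        (ExteriorAlgebra.ι R a * x) = e.coord i a • x -
          ExteriorAlgebra.ι R a * contractLeft (Q := (0 : QuadraticForm R M)) (e.coord i) x :=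
      fun i => contractLeft_ι_mul _ _ _
    have h2 : ∀ i, ExteriorAlgebra.ι R (e i) * ExteriorAlgebra.ι R a =
        -(ExteriorAlgebra.ι R a * ExteriorAlgebra.ι R (e i)) := fun i =>
      eq_neg_of_add_eq_zero_left (ExteriorAlgebra.ι_add_mul_swap _ _)
    have h3 : ∑ i, e.coord i a • (ExteriorAlgebra.ι R (e i) * x) = ExteriorAlgebra.ι R a * x := by
      conv_rhs => rw [← e.sum_repr a, map_sum, Finset.sum_mul]
      simp
    simp only [h1, mul_sub, ← mul_assoc, h2, neg_mul, sub_neg_eq_add, mul_smul_comm]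
    simp only [mul_assoc]
    rw [Finset.sum_add_distrib, ← Finset.mul_sum, ih, h3]
    push_cast
    rw [add_smul, one_smul, mul_smul_comm, add_comm]

/-- By Euler's identity, `∑ e_i ∧ (e^i ⌟ ·)` multiplies the component of degree `j` by `j`. If all
contractions of `x` vanish, characteristic zero forces every component of positive degree to vanish.
-/
lemma exterior_mem_range_algebraMap [CharZero R] [FiniteDimensional R M] {x : ExteriorAlgebra R M}
    (hx : ∀ d : Module.Dual R M, contractLeft (Q := (0 : QuadraticForm R M)) d x = 0) :
    ∃ r, x = algebraMap R (ExteriorAlgebra R M) r := by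
  set e := Module.finBasis R M
  have key : ∀ (j : ℕ) (y : ExteriorAlgebra R M), GradedRing.proj (fun i : ℕ => ⋀[R]^i M) j
      (∑ i, ExteriorAlgebra.ι R (e i) *
        contractLeft (Q := (0 : QuadraticForm R M)) (e.coord i) y) =
      (j : R) • GradedRing.proj (fun i : ℕ => ⋀[R]^i M) j y := by
    intro j y
    induction y using DirectSum.Decomposition.inductionOn (fun i : ℕ => ⋀[R]^i M) with
    | zero => simp
    | homogeneous m =>
      rename_i k
      rw [sum_ι_mul_contractLeft e m.2]
      simp only [GradedRing.proj_apply, DirectSum.decompose_smul, DirectSum.smul_apply,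
        Submodule.coe_smul]
      by_cases h : k = j
      · subst h; rfl
      · rw [DirectSum.decompose_of_mem_ne (fun i : ℕ => ⋀[R]^i M) m.2 h]; simp
    | add y z hy hz =>
      simp only [map_add, mul_add, Finset.sum_add_distrib, smul_add] at hy hz ⊢
      rw [hy, hz]
  have h0 : ∀ j : ℕ, j ≠ 0 → GradedRing.proj (fun i : ℕ => ⋀[R]^i M) j x = 0 := by
    intro j hj
    have := key j x
    simp only [hx, mul_zero, Finset.sum_const_zero, map_zero] at this
    exact (smul_eq_zero.1 this.symm).resolve_left (by exact_mod_cast hj)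
  classical
  have h1 : x = GradedRing.proj (fun i : ℕ => ⋀[R]^i M) 0 x := by
    conv_lhs => rw [← DirectSum.sum_support_decompose (fun i : ℕ => ⋀[R]^i M) x]
    rw [Finset.sum_eq_single 0]
    · rfl
    · exact fun j _ hj => h0 j hj
    · intro h
      simpa using h
  have h2 : GradedRing.proj (fun i : ℕ => ⋀[R]^i M) 0 x ∈ ⋀[R]^0 M := SetLike.coe_mem _
  rw [← h1] at h2
  change x ∈ LinearMap.range (ExteriorAlgebra.ι R : M →ₗ[R] _) ^ 0 at h2
  rw [pow_zero, Submodule.mem_one] at h2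
  exact h2.imp fun _ => Eq.symm

variable {Q : QuadraticForm R M}

/-- An element of a Clifford algebra that is killed by all contractions is a scalar. -/
lemma mem_range_algebraMap_of_contractLeft [CharZero R] [FiniteDimensional R M]
    {x : CliffordAlgebra Q} (hx : ∀ d : Module.Dual R M, contractLeft d x = 0) :
    ∃ r, x = algebraMap R (CliffordAlgebra Q) r := by
  let _ : Invertible (2 : R) := invertibleOfNonzero two_ne_zero
  -- The linear isomorphism with the exterior algebra commutes with contractions, so the exterior
  -- case applies.
  have h : ∀ d : Module.Dual R M,
      contractLeft (Q := (0 : QuadraticForm R M)) d (equivExterior Q x) = 0 := by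
    intro d
    have := changeForm_contractLeft (changeForm.associated_neg_proof (Q := Q)) d x
    rw [hx d, map_zero] at this
    exact this.symm
  obtain ⟨r, hr⟩ := exterior_mem_range_algebraMap h
  refine ⟨r, (equivExterior Q).injective (hr.trans ?_)⟩
  exact (changeForm_algebraMap changeForm.associated_neg_proof r).symm

/-- A subspace of a Clifford algebra that is stable under contractions and contains no nonzero
scalar is trivial. -/
lemma eq_bot_of_contractLeft_stable [CharZero R] [FiniteDimensional R M]
    (K : Submodule R (CliffordAlgebra Q))
    (hK : ∀ d : Module.Dual R M, ∀ x ∈ K, contractLeft d x ∈ K)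
    (h1 : ∀ r, algebraMap R (CliffordAlgebra Q) r ∈ K → r = 0) : K = ⊥ := by
  by_contra hne
  obtain ⟨x₀, hx₀, hx₀'⟩ := Submodule.exists_mem_ne_zero_of_ne_bot hne
  set e := Module.finBasis R M
  -- Contract by one coordinate at a time, whenever the result is nonzero. Contractions square to
  -- zero and anticommute, so what was killed before stays killed.
  have key : ∀ s : Finset (Fin (Module.finrank R M)), ∃ x ∈ K, x ≠ 0 ∧
      ∀ i ∈ s, contractLeft (e.coord i) x = 0 := by
    intro s
    induction s using Finset.induction_on with
    | empty => exact ⟨x₀, hx₀, hx₀', by simp⟩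
    | insert i s hi ih =>
      obtain ⟨x, hx, hx', hs⟩ := ih
      by_cases h : contractLeft (e.coord i) x = 0
      · exact ⟨x, hx, hx', by simpa [h] using hs⟩
      · refine ⟨_, hK (e.coord i) x hx, h, ?_⟩
        simp only [Finset.mem_insert, forall_eq_or_imp, contractLeft_contractLeft, true_and]
        intro j hj
        rw [contractLeft_comm, hs j hj, map_zero, neg_zero]
  obtain ⟨x, hx, hx', hs⟩ := key Finset.univ
  have hall : ∀ d : Module.Dual R M, contractLeft d x = 0 := by
    intro d
    rw [← e.sum_dual_apply_smul_coord d, map_sum, LinearMap.sum_apply]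
    exact Finset.sum_eq_zero fun i hi => by
      rw [map_smul, LinearMap.smul_apply, hs i hi, smul_zero]
  obtain ⟨r, rfl⟩ := mem_range_algebraMap_of_contractLeft hall
  exact hx' (by rw [h1 r hx, map_zero])

/-- Contraction by the polar form is the twisted commutator with a vector. -/
lemma contractLeft_polar (v : M) (x : CliffordAlgebra Q) :
    contractLeft (QuadraticMap.polarBilin Q v) x = ι Q v * x - involute x * ι Q v := by
  induction x using CliffordAlgebra.left_induction with
  | algebraMap r => simp [Algebra.commutes]
  | add x y hx hy => simp only [map_add, hx, hy, mul_add, add_mul]; abel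
  | ι_mul x m hx =>
    have h : ι Q v * ι Q m = algebraMap R _ (QuadraticMap.polar Q v m) - ι Q m * ι Q v :=
      eq_sub_of_add_eq (ι_mul_ι_add_swap v m)
    rw [contractLeft_ι_mul, hx, map_mul, involute_ι, ← mul_assoc, h, sub_mul, Algebra.smul_def,
      QuadraticMap.polarBilin_apply_apply, mul_sub]
    simp only [neg_mul, mul_assoc]
    abel

/-- A homomorphism from a nondegenerate Clifford algebra is injective on its even and on
its odd part. -/
lemma eq_zero_of_map_eq_zero [CharZero R] [FiniteDimensional R M] {A : Type*} [Ring A]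
    [Nontrivial A] [Algebra R A] (π : CliffordAlgebra Q →ₐ[R] A)
    (hQ : Function.Surjective Q.polarBilin) {s : CliffordAlgebra Q} (h1 : π s = 0)
    (h2 : π (involute s) = 0) : s = 0 := by
  -- Every functional is a polar form, so contraction is a twisted commutator `v x - involute x *
  -- v`. Asking that `π` kill both `x` and `involute x` makes the subspace stable under it.
  have hbot := eq_bot_of_contractLeft_stable (Q := Q) (LinearMap.ker π.toLinearMap ⊓
      LinearMap.ker (π.toLinearMap ∘ₗ involute.toLinearMap)) ?_ ?_
  · have : s ∈ LinearMap.ker π.toLinearMap ⊓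
      LinearMap.ker (π.toLinearMap ∘ₗ involute.toLinearMap) := ⟨h1, h2⟩
    rwa [hbot, Submodule.mem_bot] at this
  · rintro d t ⟨ht1, ht2⟩
    obtain ⟨v, rfl⟩ := hQ d
    change π t = 0 at ht1
    change π (involute t) = 0 at ht2
    rw [contractLeft_polar]
    refine ⟨?_, ?_⟩
    · change π _ = 0
      rw [map_sub, map_mul, map_mul, ht1, ht2, mul_zero, zero_mul, sub_zero]
    · change π (involute _) = 0
      rw [map_sub, map_mul, map_mul, involute_involute, map_sub, map_mul, map_mul,
        ht1, ht2, mul_zero, zero_mul, sub_zero]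
  · rintro r ⟨hr, -⟩
    change π (algebraMap R _ r) = 0 at hr
    rw [AlgHom.commutes] at hr
    exact (map_eq_zero_iff _ (algebraMap R A).injective).1 hr

lemma contractLeft_map (f : M →ₗ[R] N) (d : Module.Dual R N) (x : ExteriorAlgebra R M) :
    contractLeft (Q := (0 : QuadraticForm R N)) d (ExteriorAlgebra.map f x) =
      ExteriorAlgebra.map f (contractLeft (Q := (0 : QuadraticForm R M)) (d ∘ₗ f) x) := by
  induction x using CliffordAlgebra.left_induction with
  | algebraMap r =>
    rw [contractLeft_algebraMap, AlgHom.commutes, map_zero]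
    exact contractLeft_algebraMap _ _ _
  | add x y hx hy => simp only [map_add, hx, hy]
  | ι_mul x m hx =>
    have h1 : ExteriorAlgebra.map f (ι 0 m) = ι 0 (f m) := ExteriorAlgebra.map_apply_ι f m
    rw [map_mul, h1, contractLeft_ι_mul, contractLeft_ι_mul, hx, map_sub, map_mul, h1, map_smul]
    rfl

lemma involute_map (f : M →ₗ[R] N) (x : ExteriorAlgebra R M) :
    involute (Q := (0 : QuadraticForm R N)) (ExteriorAlgebra.map f x) =
      ExteriorAlgebra.map f (involute (Q := (0 : QuadraticForm R M)) x) := by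
  induction x using CliffordAlgebra.left_induction with
  | algebraMap r => simp
  | add x y hx hy => simp only [map_add, hx, hy]
  | ι_mul x m hx =>
    have h1 : ExteriorAlgebra.map f (ι 0 m) = ι 0 (f m) := ExteriorAlgebra.map_apply_ι f m
    simp only [map_mul, h1, involute_ι, hx, map_neg]

/-- The action on the exterior algebra of a rank one perturbation of the identity. -/
lemma map_transvection (d : Module.Dual R M) (w : M) (x : ExteriorAlgebra R M) :
    ExteriorAlgebra.map (LinearMap.id + d.smulRight w) x =
      x + ExteriorAlgebra.ι R w * contractLeft (Q := (0 : QuadraticForm R M)) d x := by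
  induction x using CliffordAlgebra.left_induction with
  | algebraMap r =>
    rw [contractLeft_algebraMap, AlgHom.commutes, mul_zero, add_zero]
  | add x y hx hy => simp only [map_add, hx, hy, mul_add]; abel
  | ι_mul x m hx =>
    have h1 : ExteriorAlgebra.map (LinearMap.id + d.smulRight w) (ι 0 m) =
        ExteriorAlgebra.ι R m + d m • ExteriorAlgebra.ι R w := by
      rw [← map_smul, ← map_add]
      exact ExteriorAlgebra.map_apply_ι _ m
    have h2 : ExteriorAlgebra.ι R w * ExteriorAlgebra.ι R m =
        -(ExteriorAlgebra.ι R m * ExteriorAlgebra.ι R w) :=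
      eq_neg_of_add_eq_zero_left (ExteriorAlgebra.ι_add_mul_swap _ _)
    have h3 : ExteriorAlgebra.ι R w * ExteriorAlgebra.ι R w = 0 := ExteriorAlgebra.ι_sq_zero w
    rw [map_mul, h1, hx, contractLeft_ι_mul]
    change _ = ExteriorAlgebra.ι R m * x + ExteriorAlgebra.ι R w * (d m • x -
      ExteriorAlgebra.ι R m * contractLeft (Q := (0 : QuadraticForm R M)) d x)
    simp only [mul_add, add_mul, mul_sub, mul_smul_comm, smul_mul_assoc, ← mul_assoc, h2, h3,
      smul_zero, neg_mul, add_zero]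
    abel

end Contraction

/-! ### Unitary matrices -/

section Unitary

variable {n : Type*} [Fintype n] [DecidableEq n]

open scoped Matrix.Norms.L2Operator in
/-- Spectral theorem for unitary matrices. -/
lemma exists_unitary_diagonalization (h : Matrix n n ℂ) (hh : h ∈ Matrix.unitaryGroup n ℂ) :
    ∃ (u : Matrix.unitaryGroup n ℂ) (θ : n → ℝ),
      h = u.1 * Matrix.diagonal (fun p => Complex.exp (θ p * Complex.I)) * star u.1 := by
  have hn : IsStarNormal h := ⟨by
    rw [Commute, SemiconjBy, Matrix.mem_unitaryGroup_iff.1 hh, Matrix.mem_unitaryGroup_iff'.1 hh]⟩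
  have hfin := Matrix.finite_spectrum h
  -- `A` is the argument of `h`, Hermitian with `exp (iA) = h`. The discontinuity of `arg` is
  -- harmless because the spectrum is finite. Diagonalizing `A` then diagonalizes `h`.
  set A : Matrix n n ℂ := cfc (fun z : ℂ => (z.arg : ℂ)) h with hA
  have hAsa : A.IsHermitian := by
    change star A = A
    rw [hA, ← cfc_star]
    simp
  have hexp : NormedSpace.exp (Complex.I • A) = h := by
    have h1 : Complex.I • A = cfc (fun z : ℂ => Complex.I * (z.arg : ℂ)) h := by
      rw [hA, cfc_const_mul Complex.I (fun z : ℂ => (z.arg : ℂ)) h (hfin.continuousOn _)]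
    have hn' : IsStarNormal (Complex.I • A) := by rw [h1]; exact cfc_predicate _ h
    rw [← CFC.exp_eq_normedSpace_exp (𝕜 := ℂ) (p := IsStarNormal) hn', h1,
      ← cfc_comp NormedSpace.exp (fun z : ℂ => Complex.I * (z.arg : ℂ)) h hn
        (hfin.image _ |>.continuousOn _) (hfin.continuousOn _)]
    conv_rhs => rw [← cfc_id ℂ h]
    refine cfc_congr fun z hz => ?_
    have hz1 : ‖z‖ = 1 := spectrum.norm_eq_one_of_unitary hh hz
    have := Complex.norm_mul_exp_arg_mul_I z
    rw [hz1, Complex.ofReal_one, one_mul] at this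
    rw [Function.comp_apply, ← Complex.exp_eq_exp_ℂ, mul_comm, this, id]
  refine ⟨hAsa.eigenvectorUnitary, hAsa.eigenvalues, ?_⟩
  have hsp := hAsa.spectral_theorem
  rw [Unitary.conjStarAlgAut_apply] at hsp
  set u := hAsa.eigenvectorUnitary
  have hu : u.1 * star u.1 = 1 := Matrix.mem_unitaryGroup_iff.1 u.2
  have hinv : u.1⁻¹ = star u.1 := Matrix.inv_eq_right_inv hu
  have hU : IsUnit u.1 := (Matrix.isUnit_iff_isUnit_det _).2 (Matrix.isUnit_det_of_right_inverse hu)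
  have hIA : Complex.I • A = u.1 * Matrix.diagonal
      (Complex.I • (RCLike.ofReal ∘ hAsa.eigenvalues : n → ℂ)) * u.1⁻¹ := by
    rw [hinv, Matrix.diagonal_smul, Matrix.mul_smul, Matrix.smul_mul]
    exact congrArg (Complex.I • ·) hsp
  rw [← hexp, hIA, Matrix.exp_conj _ _ hU, Matrix.exp_diagonal, hinv]
  congr 3
  funext p
  rw [Pi.coe_exp, ← Complex.exp_eq_exp_ℂ]
  simp [mul_comm]

/-- The determinant only gives `∑ θ_p ∈ 2πℤ`. Sum exactly zero is what halving the angles requires,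
both for square roots in `SU(n)` and for the cancellation of the spin phases. -/
lemma exists_special_unitary_diagonalization {n : ℕ} (hn : 1 ≤ n) (h : SU n) :
    ∃ (u : Matrix.unitaryGroup (Fin n) ℂ) (θ : Fin n → ℝ), ∑ p, θ p = 0 ∧
      h.1 = u.1 * Matrix.diagonal (fun p => Complex.exp (θ p * Complex.I)) * star u.1 := by
  obtain ⟨hh, hdet⟩ := Matrix.mem_specialUnitaryGroup_iff.1 h.2
  obtain ⟨u, θ, hu⟩ := exists_unitary_diagonalization h.1 hh
  have h1 : Complex.exp ((∑ p, θ p : ℝ) * Complex.I) = 1 := by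
    rw [hu, Matrix.det_mul, Matrix.det_mul, mul_right_comm, ← Matrix.det_mul,
      Matrix.mem_unitaryGroup_iff.1 u.2, Matrix.det_one, one_mul, Matrix.det_diagonal,
      ← Complex.exp_sum, ← Finset.sum_mul] at hdet
    rw [← hdet]
    push_cast
    rfl
  set q : Fin n := ⟨0, hn⟩
  -- One angle absorbs the whole sum, a multiple of `2π`, so its exponential is unchanged.
  refine ⟨u, Function.update θ q (θ q - ∑ p, θ p), ?_, ?_⟩
  · rw [Finset.sum_update_of_mem (Finset.mem_univ q),
      ← Finset.add_sum_erase Finset.univ θ (Finset.mem_univ q), Finset.sdiff_singleton_eq_erase]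
    ring
  · rw [hu]
    congr 3
    funext p
    by_cases hp : p = q
    · subst hp
      rw [Function.update_self, Complex.ofReal_sub, sub_mul, Complex.exp_sub, h1, div_one]
    · rw [Function.update_of_ne hp]

lemma star_diagonal_exp {n : ℕ} (θ : Fin n → ℝ) :
    star (Matrix.diagonal fun p => Complex.exp (θ p * Complex.I)) =
      Matrix.diagonal fun p => Complex.exp (-(θ p * Complex.I)) := by
  rw [Matrix.star_eq_conjTranspose, Matrix.diagonal_conjTranspose]
  congr 1
  funext p
  simp [← Complex.exp_conj]

lemma conj_diagonal_mem_SU {n : ℕ} (u : Matrix.unitaryGroup (Fin n) ℂ) {θ : Fin n → ℝ}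
    (hθ : ∑ p, θ p = 0) :
    u.1 * Matrix.diagonal (fun p => Complex.exp (θ p * Complex.I)) * star u.1 ∈
      Matrix.specialUnitaryGroup (Fin n) ℂ := by
  have h1 : Matrix.diagonal (fun p => Complex.exp (θ p * Complex.I)) ∈
      Matrix.unitaryGroup (Fin n) ℂ := by
    rw [Matrix.mem_unitaryGroup_iff, star_diagonal_exp, Matrix.diagonal_mul_diagonal]
    simp [← Complex.exp_add]
  refine Matrix.mem_specialUnitaryGroup_iff.2
    ⟨mul_mem (mul_mem u.2 h1) (star u).2, ?_⟩
  rw [Matrix.det_mul, Matrix.det_mul, mul_right_comm, ← Matrix.det_mul,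
      Matrix.mem_unitaryGroup_iff.1 u.2, Matrix.det_one, one_mul, Matrix.det_diagonal,
      ← Complex.exp_sum, ← Finset.sum_mul, ← Complex.ofReal_sum, hθ]
  simp

/-- Every element of `SU(n)` has a square root. -/
lemma exists_sq_eq {n : ℕ} (hn : 1 ≤ n) (h : SU n) : ∃ k : SU n, k * k = h := by
  obtain ⟨u, θ, hθ, hu⟩ := exists_special_unitary_diagonalization hn h
  -- Halved angles still have sum zero, so the root has determinant one.
  refine ⟨⟨_, conj_diagonal_mem_SU u (θ := fun p => θ p / 2) ?_⟩, Subtype.ext ?_⟩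
  · rw [← Finset.sum_div, hθ, zero_div]
  · rw [hu]
    change u.1 * _ * star u.1 * (u.1 * _ * star u.1) = _
    rw [show ∀ D : Matrix (Fin n) (Fin n) ℂ, u.1 * D * star u.1 * (u.1 * D * star u.1) =
      u.1 * D * (star u.1 * u.1) * D * star u.1 from fun D => by simp only [Matrix.mul_assoc],
      Matrix.mem_unitaryGroup_iff'.1 u.2, mul_one, Matrix.mul_assoc u.1,
      Matrix.diagonal_mul_diagonal]
    congr 3
    funext p
    rw [← Complex.exp_add]
    congr 1
    push_cast
    ring

end Unitary

/-! ### Clifford multiplication in coordinates -/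

lemma linearIndependent_y₀ (n : ℕ) {b : ℝ} (hb : 0 < b) : LinearIndependent ℂ (y₀ n b) := by
  rw [Fintype.linearIndependent_iff]
  intro c hc p
  -- Pairing with `x_p` isolates the coefficient of `y_p`. The value `a = 1` is arbitrary, since the
  -- pairing does not depend on `a`.
  have := congrArg (β n 1 b (x n b p)) hc
  simpa [β_x_y n 1 hb] using this

/-- The basis `y₁, …, y_n` of `L'`. -/
def yBasis (n : ℕ) {b : ℝ} (hb : 0 < b) : Module.Basis (Fin n) ℂ (L' n b) :=
  Module.Basis.span (linearIndependent_y₀ n hb)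

section

variable {n : ℕ} {a b : ℝ}

lemma yBasis_apply (hb : 0 < b) (p : Fin n) : yBasis n hb p = y n b p :=
  Subtype.ext (Module.Basis.coe_span_apply _ p)

lemma β_x_comp_subtype (a : ℝ) (hb : 0 < b) (p : Fin n) :
    β n a b (x n b p) ∘ₗ (L' n b).subtype = (yBasis n hb).coord p := by
  refine (yBasis n hb).ext fun q => ?_
  have := β_x_y n a hb p q
  rw [LinearMap.comp_apply, Module.Basis.coord_apply, Module.Basis.repr_self, yBasis_apply]
  rw [Finsupp.single_apply, if_congr eq_comm rfl rfl]
  exact this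

/-- The first column of `X ∈ 𝔪`, below the diagonal. -/
def col (X : 𝔪 n) : Fin n → ℂ := fun p => X.1 p.succ 0

/-- The vector `∑ conj(z_p) y_p` of `L'`. -/
def wv (hb : 0 < b) (z : Fin n → ℂ) : L' n b := ∑ p, star (z p) • yBasis n hb p

/-- The functional `∑ z_p y^p` on `L'`. -/
def dv (hb : 0 < b) (z : Fin n → ℂ) : Module.Dual ℂ (L' n b) := ∑ p, z p • (yBasis n hb).coord p

lemma wv_smul (hb : 0 < b) (c : ℂ) (z : Fin n → ℂ) : wv hb (c • z) = star c • wv hb z := by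
  simp [wv, Finset.smul_sum, mul_smul]

lemma dv_smul (hb : 0 < b) (c : ℂ) (z : Fin n → ℂ) : dv hb (c • z) = c • dv hb z := by
  simp [dv, Finset.smul_sum, mul_smul]

lemma dv_yBasis (hb : 0 < b) (z : Fin n → ℂ) (q : Fin n) : dv hb z (yBasis n hb q) = z q := by
  simp [dv, Finsupp.single_apply]

lemma dv_wv (hb : 0 < b) (z w : Fin n → ℂ) : dv hb z (wv hb w) = ∑ p, z p * star (w p) := by
  simp [wv, dv_yBasis, mul_comm]

lemma mul_inv_sqrt (hb : 0 < b) : b * ((√(2 * b))⁻¹ * 2) = √(2 * b) := by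
  have h : √(2 * b) ≠ 0 := by positivity
  field_simp
  rw [Real.sq_sqrt (by positivity)]

/-- The operator `η ↦ t (-1)^{deg η} η + d ⌟ η + w ∧ η` on an exterior algebra. -/
def fock {M : Type*} [AddCommGroup M] [Module ℂ M] (t : ℂ) (d : Module.Dual ℂ M) (w : M) :
    Module.End ℂ (ExteriorAlgebra ℂ M) :=
  t • (CliffordAlgebra.involute (Q := (0 : QuadraticForm ℂ M))).toLinearMap +
    (CliffordAlgebra.contractLeft (Q := (0 : QuadraticForm ℂ M)) d +
      LinearMap.mulLeft ℂ (ExteriorAlgebra.ι ℂ w))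

lemma fock_apply {M : Type*} [AddCommGroup M] [Module ℂ M] (t : ℂ) (d : Module.Dual ℂ M) (w : M)
    (η : ExteriorAlgebra ℂ M) : fock t d w η =
      t • CliffordAlgebra.involute (Q := (0 : QuadraticForm ℂ M)) η +
        (CliffordAlgebra.contractLeft (Q := (0 : QuadraticForm ℂ M)) d η +
          ExteriorAlgebra.ι ℂ w * η) := rfl

lemma map_fock {M : Type*} [AddCommGroup M] [Module ℂ M] (f : M →ₗ[ℂ] M) (t : ℂ)
    {d d' : Module.Dual ℂ M} (hd : d' ∘ₗ f = d) (w : M) :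
    (ExteriorAlgebra.map f).toLinearMap * fock t d w =
      fock t d' (f w) * (ExteriorAlgebra.map f).toLinearMap := by
  refine LinearMap.ext fun η => ?_
  rw [Module.End.mul_apply, Module.End.mul_apply, AlgHom.toLinearMap_apply,
    AlgHom.toLinearMap_apply, fock_apply, fock_apply, contractLeft_map, hd, involute_map, map_add,
    map_smul, map_add, map_mul, ExteriorAlgebra.map_apply_ι]

/-- For a column entry `z`, the coefficients of `e_{2p}` and `e_{2p+1}` are `√(2b) Re z` and `√(2b)
Im z`. They combine to `i Re z - Im z = i z` on the contraction and `i Re z + Im z = i conj(z)` on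
the exterior multiplication. -/
lemma cliffordMul_eq (a : ℝ) (hb : 0 < b) (X : 𝔪 n) :
    cliffordMul n a b X = fock (Complex.I * (g n a b X (e₁ n a) : ℂ))
      ((Complex.I * (√(2 * b) : ℂ)) • dv hb (col X))
      ((Complex.I * (√(2 * b) : ℂ)) • wv hb (col X)) := by
  have hS : ((b : ℂ) * ((√(2 * b) : ℂ)⁻¹ * 2)) = (√(2 * b) : ℂ) := by
    exact_mod_cast mul_inv_sqrt hb
  have h1 : ∑ p, (Complex.I * (g n a b X (eEven n b p) : ℂ) - (g n a b X (eOdd n b p) : ℂ)) •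
      (β n a b (x n b p) ∘ₗ (L' n b).subtype) =
        (Complex.I * (√(2 * b) : ℂ)) • dv hb (col X) := by
    rw [dv, Finset.smul_sum]
    refine Finset.sum_congr rfl fun p _ => ?_
    rw [β_x_comp_subtype a hb, smul_smul, g_eEven, g_eOdd, ← hS]
    congr 1
    conv_rhs => rw [col, ← Complex.re_add_im (X.1 p.succ 0)]
    push_cast
    ring_nf
    rw [Complex.I_sq]
    ring
  have h2 : ∑ p, (Complex.I * (g n a b X (eEven n b p) : ℂ) + (g n a b X (eOdd n b p) : ℂ)) •
      y n b p = (Complex.I * (√(2 * b) : ℂ)) • wv hb (col X) := by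
    rw [wv, Finset.smul_sum]
    refine Finset.sum_congr rfl fun p _ => ?_
    rw [yBasis_apply, smul_smul, g_eEven, g_eOdd, ← hS]
    congr 1
    have : star (col X p) = ((X.1 p.succ 0).re : ℂ) - (X.1 p.succ 0).im * Complex.I := by
      rw [col]
      apply Complex.ext <;> simp
    rw [this]
    push_cast
    ring_nf
    rw [Complex.I_sq]
    ring
  rw [← h1, ← h2]
  exact LinearMap.ext fun η => (cliffordMul_apply n a b X η).trans
    (fock_sum (fun p => β n a b (x n b p) ∘ₗ (L' n b).subtype) (y n b) _ _ _ η)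

/-! ### The action of matrices on `Σ` -/

/-- The action of a matrix on `L'`, by its entrywise conjugate in the basis `y`. -/
def cj (hb : 0 < b) (A : Matrix (Fin n) (Fin n) ℂ) : L' n b →ₗ[ℂ] L' n b :=
  Matrix.toLin (yBasis n hb) (yBasis n hb) (A.map star)

lemma cj_yBasis (hb : 0 < b) (A : Matrix (Fin n) (Fin n) ℂ) (q : Fin n) :
    cj hb A (yBasis n hb q) = ∑ p, star (A p q) • yBasis n hb p := by
  simp [cj, Matrix.toLin_self]

lemma cj_one (hb : 0 < b) : cj hb (1 : Matrix (Fin n) (Fin n) ℂ) = LinearMap.id := by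
  rw [cj, Matrix.map_one _ (star_zero _) (star_one _), Matrix.toLin_one]

lemma cj_mul (hb : 0 < b) (A B : Matrix (Fin n) (Fin n) ℂ) :
    cj hb (A * B) = cj hb A ∘ₗ cj hb B := by
  rw [cj, cj, cj, ← Matrix.toLin_mul]
  congr 1
  ext i j
  simp [Matrix.mul_apply]

/-- The action of a matrix on `Σ = Λ^• L'`. -/
def Λ (hb : 0 < b) (A : Matrix (Fin n) (Fin n) ℂ) : Module.End ℂ (Spinor n b) :=
  (ExteriorAlgebra.map (cj hb A)).toLinearMap

lemma Λ_one (hb : 0 < b) : Λ hb (1 : Matrix (Fin n) (Fin n) ℂ) = 1 := by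
  rw [Λ, cj_one, ExteriorAlgebra.map_id]
  rfl

lemma Λ_mul (hb : 0 < b) (A B : Matrix (Fin n) (Fin n) ℂ) :
    Λ hb (A * B) = Λ hb A * Λ hb B := by
  rw [Λ, cj_mul, ← ExteriorAlgebra.map_comp_map]
  rfl

lemma wv_mulVec (hb : 0 < b) (A : Matrix (Fin n) (Fin n) ℂ) (z : Fin n → ℂ) :
    wv hb (A *ᵥ z) = cj hb A (wv hb z) := by
  simp only [wv, map_sum, map_smul, cj_yBasis, Finset.smul_sum, Matrix.mulVec, dotProduct,
    star_sum, star_mul', Finset.sum_smul]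
  rw [Finset.sum_comm]
  refine Finset.sum_congr rfl fun q _ => Finset.sum_congr rfl fun p _ => ?_
  rw [smul_smul, mul_comm]

/-- Evaluating on `y_q` gives the `q`-th entry of `A* A z`, so unitarity is exactly what is needed.
-/
lemma dv_mulVec_comp (hb : 0 < b) {A : Matrix (Fin n) (Fin n) ℂ}
    (hA : A ∈ Matrix.unitaryGroup (Fin n) ℂ) (z : Fin n → ℂ) :
    dv hb (A *ᵥ z) ∘ₗ cj hb A = dv hb z := by
  refine (yBasis n hb).ext fun q => ?_
  rw [LinearMap.comp_apply, cj_yBasis, map_sum, dv_yBasis]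
  simp only [map_smul, dv_yBasis, smul_eq_mul]
  have h : (star A *ᵥ (A *ᵥ z)) q = z q := by
    rw [Matrix.mulVec_mulVec, Matrix.mem_unitaryGroup_iff'.1 hA, Matrix.one_mulVec]
  rw [← h]
  rfl

lemma col_isotropy (h : SU n) (X : 𝔪 n) : col (isotropy n h X) = h.1 *ᵥ col X := by
  funext p
  change (blockDiag 1 h.1 * X.1 * star (blockDiag 1 h.1)) p.succ 0 = _
  rw [blockDiag_star, Matrix.mul_apply, Fin.sum_univ_succ]
  simp [Matrix.mul_apply, Fin.sum_univ_succ, Matrix.mulVec, dotProduct, col]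

lemma pr₁_isotropy (h : SU n) (X : 𝔪 n) : pr₁ n (isotropy n h X) = pr₁ n X := by
  rw [pr₁_apply, pr₁_apply]
  congr 2
  change B₀ (n + 1) (ξ n) (blockDiag 1 h.1 * X.1 * star (blockDiag 1 h.1)) = _
  have hh := Matrix.mem_unitaryGroup_iff'.1 (Matrix.mem_specialUnitaryGroup_iff.1 h.2).1
  rw [B₀_apply, B₀_apply, ← Matrix.mul_assoc, Matrix.trace_mul_comm, ← Matrix.mul_assoc,
    ← Matrix.mul_assoc, ξ, blockDiag_star, blockDiag_mul, blockDiag_mul]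
  simp [hh]

lemma g_isotropy_e₁ (hn : 1 ≤ n) (a b : ℝ) (h : SU n) (X : 𝔪 n) :
    g n a b (isotropy n h X) (e₁ n a) = g n a b X (e₁ n a) := by
  have hn1 : (n * (n + 1) : ℝ) ≠ 0 := by positivity
  have h1 : pr₁ n ⟨ξ n, ξ_mem n⟩ = ξ n := by
    rw [pr₁_apply, B₀_ξ_ξ, inv_mul_cancel₀ hn1, one_smul]
  have h2 : pr₂ n (e₁ n a) = 0 := by
    rw [e₁, map_smul, pr₂_apply, h1, sub_self, smul_zero]
  rw [g_apply, g_apply, h2, pr₁_isotropy, map_zero, map_zero]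

/-- The action of `SU(n)` on `Σ` is compatible with Clifford multiplication. -/
lemma Λ_cliffordMul (hn : 1 ≤ n) (a : ℝ) (hb : 0 < b) (h : SU n) (X : 𝔪 n) :
    Λ hb h.1 * cliffordMul n a b X = cliffordMul n a b (isotropy n h X) * Λ hb h.1 := by
  have hh := (Matrix.mem_specialUnitaryGroup_iff.1 h.2).1
  rw [cliffordMul_eq a hb, cliffordMul_eq a hb, g_isotropy_e₁ hn, col_isotropy, wv_mulVec,
    ← map_smul]
  refine map_fock _ _ ?_ _
  rw [LinearMap.smul_comp, dv_mulVec_comp hb hh]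

end

/-! ### Nondegeneracy of the metric and faithfulness of the Clifford representation -/

section

variable {n : ℕ} {a b : ℝ}

lemma g_e₁ (hn : 1 ≤ n) (a b : ℝ) (X : 𝔪 n) :
    g n a b X (e₁ n a) = a * (√(a * n * (n + 1)))⁻¹ * B₀ (n + 1) (ξ n) X.1 := by
  have hn1 : (n * (n + 1) : ℝ) ≠ 0 := by positivity
  have h1 : pr₁ n ⟨ξ n, ξ_mem n⟩ = ξ n := by
    rw [pr₁_apply, B₀_ξ_ξ, inv_mul_cancel₀ hn1, one_smul]
  have h2 : pr₂ n (e₁ n a) = 0 := by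
    rw [e₁, map_smul, pr₂_apply, h1, sub_self, smul_zero]
  rw [g_apply, h2, map_zero, mul_zero, add_zero, pr₁_apply, e₁, map_smul (pr₁ n), h1, map_smul, map_smul,
    LinearMap.smul_apply, B₀_ξ_ξ, smul_eq_mul, smul_eq_mul]
  field_simp

lemma g_self_eq (hn : 1 ≤ n) (ha : 0 < a) (hb : 0 < b) (X : 𝔪 n) :
    g n a b X X = g n a b X (e₁ n a) ^ 2 + 2 * b * ∑ p, Complex.normSq (col X p) := by
  rw [g_self hn ha hb, Finset.mul_sum]
  congr 1
  refine Finset.sum_congr rfl fun p _ => ?_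
  have h : √(2 * b) ^ 2 = 2 * b := Real.sq_sqrt (by positivity)
  have h' := mul_inv_sqrt hb
  rw [g_eEven, g_eOdd, Complex.normSq_apply, col]
  calc _ = (b * ((√(2 * b))⁻¹ * 2)) ^ 2 *
      ((X.1 p.succ 0).re * (X.1 p.succ 0).re + (X.1 p.succ 0).im * (X.1 p.succ 0).im) := by ring
    _ = _ := by rw [h', h]

lemma eq_zero_of_g_self (hn : 1 ≤ n) (ha : 0 < a) (hb : 0 < b) {X : 𝔪 n}
    (hX : g n a b X X = 0) : X = 0 := by
  have hs : 0 ≤ ∑ p, Complex.normSq (col X p) :=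
    Finset.sum_nonneg fun p _ => Complex.normSq_nonneg _
  rw [g_self_eq hn ha hb] at hX
  have h1 : g n a b X (e₁ n a) = 0 := by
    have : 0 ≤ 2 * b * ∑ p, Complex.normSq (col X p) := by positivity
    nlinarith [sq_nonneg (g n a b X (e₁ n a))]
  have h2 : ∑ p, Complex.normSq (col X p) = 0 := by
    rw [h1] at hX
    have : 2 * b ≠ 0 := by positivity
    simpa [this, hb.ne'] using hX
  have h3 : ∀ p : Fin n, X.1 p.succ 0 = 0 := fun p => Complex.normSq_eq_zero.1
    ((Finset.sum_eq_zero_iff_of_nonneg fun p _ => Complex.normSq_nonneg _).1 h2 p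
      (Finset.mem_univ p))
  have h4 : ∀ p, X.1 0 (Fin.succ p) = 0 := fun p => Complex.ext
    (by rw [𝔪_re X p.succ 0, h3]; simp) (by rw [𝔪_im X p.succ 0, h3])
  -- The entry is imaginary. The lower block is the scalar `-X₀₀/n`, so the `e₁`-coefficient is a
  -- nonzero multiple of `(n + 1) Im X₀₀`.
  have h5 : X.1 0 0 = 0 := by
    refine Complex.ext ?_ ?_
    · have := 𝔪_re X 0 0
      rw [Complex.zero_re]; linarith
    · have hn0 : (0 : ℝ) < n := by exact_mod_cast hn
      have hdiag : ∀ p : Fin n, (X.1 p.succ p.succ).im = -(X.1 0 0).im / n := by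
        intro p
        rw [scalar_block hn X.2 p p, if_pos rfl]
        rw [← Complex.ofReal_natCast, Complex.div_ofReal_im, Complex.neg_im]
      rw [g_e₁ hn, B₀_ξ] at h1
      simp only [hdiag, Finset.sum_const, Finset.card_univ, Fintype.card_fin, nsmul_eq_mul] at h1
      rw [mul_div_cancel₀ _ hn0.ne'] at h1
      have h6 : a * (√(a * n * (n + 1)))⁻¹ ≠ 0 := by positivity
      have h7 := (mul_eq_zero.1 h1).resolve_left h6
      rw [Complex.zero_im]
      have h8 : ((n : ℝ) + 1) * (X.1 0 0).im = 0 := by linarith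
      exact (mul_eq_zero.1 h8).resolve_left (by positivity)
  refine Subtype.ext (Matrix.ext fun i j => ?_)
  cases i using Fin.cases with
  | zero => cases j using Fin.cases with
    | zero => exact h5
    | succ q => exact h4 q
  | succ p => cases j using Fin.cases with
    | zero => exact h3 p
    | succ q => rw [scalar_block hn X.2 p q, h5]; simp

/-- The polar form on the diagonal is `-2 g(X, X)`, so definiteness gives injectivity, and equality
of dimensions gives surjectivity. -/
lemma exists_polarBilin_eq (hn : 1 ≤ n) (ha : 0 < a) (hb : 0 < b) (d : Module.Dual ℝ (𝔪 n)) :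
    ∃ X, (Q n a b).polarBilin X = d := by
  have hinj : Function.Injective (Q n a b).polarBilin := by
    rw [injective_iff_map_eq_zero]
    intro X hX
    refine eq_zero_of_g_self hn ha hb (X := X) ?_
    have h := LinearMap.congr_fun hX X
    rw [QuadraticMap.polarBilin_apply_apply, QuadraticMap.polar_self] at h
    have h' : (2 : ℝ) • -(g n a b X X) = 0 := by exact_mod_cast h
    simpa using h'
  exact (LinearMap.injective_iff_surjective_of_finrank_eq_finrank
    (Subspace.dual_finrank_eq (K := ℝ) (V := 𝔪 n)).symm).1 hinj d

lemma cliffordRep_ι (hn : 1 ≤ n) (ha : 0 < a) (hb : 0 < b) (X : 𝔪 n) :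
    cliffordRep hn ha hb (CliffordAlgebra.ι (Q n a b) X) = cliffordMul n a b X :=
  CliffordAlgebra.lift_ι_apply _ _ _

/-- An even element of the Clifford algebra that commutes with all vectors is a scalar. -/
lemma exists_algebraMap_of_commute (hn : 1 ≤ n) (ha : 0 < a) (hb : 0 < b)
    {s : CliffordAlgebra (Q n a b)} (h1 : CliffordAlgebra.involute s = s)
    (h2 : ∀ X, s * CliffordAlgebra.ι (Q n a b) X = CliffordAlgebra.ι (Q n a b) X * s) :
    ∃ r, s = algebraMap ℝ _ r := by
  refine mem_range_algebraMap_of_contractLeft fun d => ?_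
  obtain ⟨X, rfl⟩ := exists_polarBilin_eq hn ha hb d
  rw [contractLeft_polar, h1, h2, sub_self]

/-! ### Spin lifts of unitary quasi-reflections -/

/-- A vector with `q v = -1` squares to `-1` and its star is `-v`, so it is unitary with inverse
`-v`; a product of two such vectors is even. -/
lemma ι_mul_ι_mem_spinGroup {V : Type*} [AddCommGroup V] [Module ℝ V] {q : QuadraticForm ℝ V}
    {v w : V} (hv : q v = -1) (hw : q w = -1) :
    CliffordAlgebra.ι q v * CliffordAlgebra.ι q w ∈ spinGroup q := by
  have hpin : ∀ u : V, q u = -1 → CliffordAlgebra.ι q u ∈ pinGroup q := by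
    intro u hu
    have h1 : CliffordAlgebra.ι q u * CliffordAlgebra.ι q u = -1 := by
      rw [CliffordAlgebra.ι_sq_scalar, hu, map_neg, map_one]
    refine pinGroup.mem_iff.2 ⟨⟨⟨CliffordAlgebra.ι q u, -CliffordAlgebra.ι q u, ?_, ?_⟩,
      Subgroup.subset_closure ⟨u, rfl⟩, rfl⟩, ?_⟩
    · rw [mul_neg, h1, neg_neg]
    · rw [neg_mul, h1, neg_neg]
    · rw [Unitary.mem_iff, CliffordAlgebra.star_ι, mul_neg, neg_mul, h1, neg_neg]
      exact ⟨rfl, rfl⟩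
  exact spinGroup.mem_iff.2 ⟨mul_mem (hpin v hv) (hpin w hw),
    CliffordAlgebra.ι_mul_ι_mem_evenOdd_zero q v w⟩

/-- The element of `𝔪₂` with first column `z`. -/
def vec (z : Fin n → ℂ) : 𝔪 n :=
  ∑ p, ((z p).re • ⟨E n p, E_mem n p⟩ + (z p).im • ⟨Complex.I • F n p, F_mem n p⟩)

lemma vec_coe (z : Fin n → ℂ) :
    (vec z).1 = ∑ p, ((z p).re • E n p + (z p).im • Complex.I • F n p) := by
  simp [vec]

lemma col_vec (z : Fin n → ℂ) : col (vec z) = z := by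
  funext q
  rw [col, vec_coe, Matrix.sum_apply, Finset.sum_eq_single q]
  · apply Complex.ext <;> simp [E, F]
  · intro p _ hp
    simp [E, F, hp]
  · simp

lemma g_vec_e₁ (hn : 1 ≤ n) (a b : ℝ) (z : Fin n → ℂ) : g n a b (vec z) (e₁ n a) = 0 := by
  have h : ∀ p, B₀ (n + 1) (ξ n) (E n p) = 0 ∧ B₀ (n + 1) (ξ n) (Complex.I • F n p) = 0 :=
    fun p => ⟨by rw [B₀_comm, B₀_E]; simp [ξ], by rw [B₀_comm, B₀_F]; simp [ξ]⟩
  rw [g_e₁ hn, vec_coe, map_sum]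
  simp only [map_add, map_smul, (h _).1, (h _).2]
  simp

lemma Q_vec (hn : 1 ≤ n) (ha : 0 < a) (hb : 0 < b) (z : Fin n → ℂ) :
    Q n a b (vec z) = -(2 * b * ∑ p, Complex.normSq (z p)) := by
  change -(g n a b (vec z) (vec z)) = _
  rw [g_self_eq hn ha hb, g_vec_e₁ hn, col_vec]
  simp

/-- The vector of `𝔪₂` with column `z`, normalized to have norm `|z|`. -/
def uvec (b : ℝ) (z : Fin n → ℂ) : 𝔪 n := vec (((√(2 * b))⁻¹ : ℂ) • z)

lemma Q_uvec (hn : 1 ≤ n) (ha : 0 < a) (hb : 0 < b) {z : Fin n → ℂ}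
    (hz : ∑ p, Complex.normSq (z p) = 1) : Q n a b (uvec b z) = -1 := by
  rw [uvec, Q_vec hn ha hb]
  simp only [Pi.smul_apply, smul_eq_mul, map_mul, ← Finset.mul_sum, hz, map_inv₀,
    Complex.normSq_ofReal, Real.mul_self_sqrt (by positivity : 0 ≤ 2 * b)]
  field_simp

lemma cliffordMul_uvec (hn : 1 ≤ n) (a : ℝ) (hb : 0 < b) (z : Fin n → ℂ) :
    cliffordMul n a b (uvec b z) = fock 0 (Complex.I • dv hb z) (Complex.I • wv hb z) := by
  have hS : (√(2 * b) : ℂ) ≠ 0 := by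
    have : √(2 * b) ≠ 0 := by positivity
    exact_mod_cast this
  have hs : star ((√(2 * b) : ℂ)⁻¹) = (√(2 * b) : ℂ)⁻¹ := by
    rw [star_inv₀]; congr 1; exact Complex.conj_ofReal _
  rw [cliffordMul_eq a hb, uvec, g_vec_e₁ hn, col_vec, dv_smul, wv_smul, hs, smul_smul, smul_smul,
    mul_assoc, mul_inv_cancel₀ hS, mul_one, Complex.ofReal_zero, mul_zero]

/-- With `d` also denoting contraction and `w` exterior multiplication, `d² = w² = 0` and `dw + wd =
1`. Hence `-(d + w)(c d - c' w) = c' dw - c wd = c' - (c + c') wd = c' (1 + μ wd)`, and `1 + μ wd`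
is the exterior power of a rank one perturbation of the identity, by `map_transvection`. -/
lemma fock_mul_fock {M : Type*} [AddCommGroup M] [Module ℂ M] {d : Module.Dual ℂ M} {w : M}
    (hdw : d w = 1) {c c' μ : ℂ} (hc : c = -c' * (1 + μ)) :
    fock 0 (Complex.I • d) (Complex.I • w) * fock 0 (Complex.I • c • d) (Complex.I • -c' • w) =
      c' • (ExteriorAlgebra.map (LinearMap.id + d.smulRight (μ • w))).toLinearMap := by
  refine LinearMap.ext fun η => ?_
  have hcc := CliffordAlgebra.contractLeft_contractLeft d (Q := (0 : QuadraticForm ℂ M)) η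
  have hcw : CliffordAlgebra.contractLeft (Q := (0 : QuadraticForm ℂ M)) d
      (ExteriorAlgebra.ι ℂ w * η) = d w • η - ExteriorAlgebra.ι ℂ w *
        CliffordAlgebra.contractLeft (Q := (0 : QuadraticForm ℂ M)) d η :=
    CliffordAlgebra.contractLeft_ι_mul d w η
  have hww : ExteriorAlgebra.ι ℂ w * (ExteriorAlgebra.ι ℂ w * η) = 0 := by
    rw [← mul_assoc, ExteriorAlgebra.ι_sq_zero, zero_mul]
  rw [Module.End.mul_apply, LinearMap.smul_apply, AlgHom.toLinearMap_apply, map_transvection,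
    fock_apply, fock_apply]
  simp only [zero_smul, zero_add, map_add, map_smul, LinearMap.smul_apply, smul_mul_assoc,
    mul_add, mul_smul_comm, hcc, hcw, hww, hdw, smul_zero, add_zero, one_smul]
  generalize ExteriorAlgebra.ι ℂ w * CliffordAlgebra.contractLeft (Q := (0 : QuadraticForm ℂ M)) d η
    = A
  subst hc
  match_scalars
  · ring_nf; simp
  · ring_nf; simp

lemma cj_quasiReflection (hb : 0 < b) (v : Fin n → ℂ) (c : ℂ) :
    cj hb (1 + c • Matrix.vecMulVec v (star v)) =
      LinearMap.id + (dv hb v).smulRight (star c • wv hb v) := by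
  refine (yBasis n hb).ext fun q => ?_
  rw [cj_yBasis, LinearMap.add_apply, LinearMap.smulRight_apply, dv_yBasis, LinearMap.id_apply, wv]
  simp only [Matrix.add_apply, Matrix.smul_apply, Matrix.vecMulVec_apply, star_add, add_smul,
    Finset.sum_add_distrib, Finset.smul_sum, smul_smul, Pi.star_apply, smul_eq_mul, star_mul',
    star_star]
  congr 1
  · rw [Finset.sum_eq_single q]
    · simp
    · intro p _ hp; simp [hp]
    · simp
  · refine Finset.sum_congr rfl fun p _ => ?_
    congr 1
    ring

/-- A unitary quasi-reflection with angle `θ` acts on `Σ`, up to the factor `e^{iθ/2}`, by an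
element of the spin group. -/
lemma exists_spin_quasiReflection (hn : 1 ≤ n) (ha : 0 < a) (hb : 0 < b) {v : Fin n → ℂ}
    (hv : ∑ p, Complex.normSq (v p) = 1) (θ : ℝ) :
    ∃ s : Spin n a b, cliffordRep hn ha hb (s : CliffordAlgebra (Q n a b)) =
      Complex.exp (θ * Complex.I / 2) •
        Λ hb (1 + (Complex.exp (θ * Complex.I) - 1) • Matrix.vecMulVec v (star v)) := by
  -- The second unit vector is `c v`. Then `-star c = e^{iθ/2}` is the phase `c'` of
  -- `fock_mul_fock`, and `c = -c' (1 + μ)` holds with `μ = e^{-iθ} - 1`, conjugate to the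
  -- coefficient of the quasi-reflection because `cj` conjugates entries.
  set c : ℂ := -Complex.exp (-(θ * Complex.I / 2)) with hc
  have hsc : star c = -Complex.exp (θ * Complex.I / 2) := by
    rw [hc, star_neg]
    congr 1
    change (starRingEnd ℂ) _ = _
    rw [← Complex.exp_conj]
    congr 1
    simp [neg_div, Complex.conj_ofNat]
  have hcn : Complex.normSq c = 1 := by
    rw [hc, Complex.normSq_neg, Complex.normSq_eq_norm_sq, Complex.norm_exp]
    simp
  have hv2 : ∑ p, Complex.normSq ((c • v) p) = 1 := by
    simp only [Pi.smul_apply, smul_eq_mul, map_mul, ← Finset.mul_sum, hv, hcn, mul_one]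
  refine ⟨⟨_, ι_mul_ι_mem_spinGroup (Q_uvec hn ha hb hv) (Q_uvec hn ha hb hv2)⟩, ?_⟩
  have hdw : dv hb v (wv hb v) = 1 := by
    rw [dv_wv]
    have : ∀ p, v p * star (v p) = (Complex.normSq (v p) : ℂ) := fun p => Complex.mul_conj _
    simp only [this]
    exact_mod_cast hv
  have h1 : c = -Complex.exp (θ * Complex.I / 2) *
      (1 + star (Complex.exp (θ * Complex.I) - 1)) := by
    have h2 : star (Complex.exp (θ * Complex.I)) = Complex.exp (-(θ * Complex.I)) := by
      change (starRingEnd ℂ) _ = _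
      rw [← Complex.exp_conj]
      congr 1
      simp
    rw [star_sub, star_one, h2, hc, add_sub_cancel, neg_mul, ← Complex.exp_add]
    congr 2
    ring
  have h4 := cliffordMul_uvec hn a hb (c • v)
  rw [dv_smul, wv_smul, hsc] at h4
  refine Eq.trans ?_ ((fock_mul_fock hdw h1).trans (congrArg (fun f => _ •
    (ExteriorAlgebra.map f).toLinearMap) (cj_quasiReflection hb v _).symm))
  exact (map_mul (cliffordRep hn ha hb) _ _).trans (congrArg₂ (· * ·)
    ((cliffordRep_ι hn ha hb _).trans (cliffordMul_uvec hn a hb v))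
    ((cliffordRep_ι hn ha hb _).trans h4))

end

/-! ### The spin lift -/

section

variable {n : ℕ} {a b : ℝ}

lemma unitary_col_normSq (u : Matrix.unitaryGroup (Fin n) ℂ) (q : Fin n) :
    ∑ p, Complex.normSq (u.1 p q) = 1 := by
  have h := congrFun (congrFun (Matrix.mem_unitaryGroup_iff'.1 u.2) q) q
  rw [Matrix.mul_apply, Matrix.one_apply_eq] at h
  have h' : ∀ p, (star u.1) q p * u.1 p q = (Complex.normSq (u.1 p q) : ℂ) := fun p => by
    rw [mul_comm]; exact Complex.mul_conj _
  simp only [h'] at h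
  exact_mod_cast h

/-- The projection onto the `q`-th column of `u` is `u E_qq u*`. The quasi-reflection is therefore
diagonal in the same eigenbasis and only changes the `q`-th eigenvalue, from `1` to `c`. -/
lemma conj_diagonal_update (u : Matrix.unitaryGroup (Fin n) ℂ) (q : Fin n) (c : ℂ)
    (D : Fin n → ℂ) (hD : D q = 1) :
    (1 + (c - 1) • Matrix.vecMulVec (fun p => u.1 p q) (star fun p => u.1 p q)) *
        (u.1 * Matrix.diagonal D * star u.1) =
      u.1 * Matrix.diagonal (Function.update D q c) * star u.1 := by
  have h1 : Matrix.vecMulVec (fun p => u.1 p q) (star fun p => u.1 p q) =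
      u.1 * Matrix.diagonal (Pi.single q 1) * star u.1 := by
    ext i j
    rw [Matrix.mul_apply, Finset.sum_eq_single q]
    · simp [Matrix.vecMulVec_apply, Matrix.mul_diagonal, Matrix.star_apply]
    · intro p _ hp
      simp [Matrix.mul_diagonal, hp]
    · simp
  have h2 : (1 : Matrix (Fin n) (Fin n) ℂ) = u.1 * Matrix.diagonal 1 * star u.1 := by
    rw [Matrix.diagonal_one', mul_one, Matrix.mem_unitaryGroup_iff.1 u.2]
  have h3 : ∀ A B : Matrix (Fin n) (Fin n) ℂ,
      u.1 * A * star u.1 * (u.1 * B * star u.1) = u.1 * (A * B) * star u.1 := fun A B => by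
    rw [show u.1 * A * star u.1 * (u.1 * B * star u.1) =
      u.1 * A * (star u.1 * u.1) * B * star u.1 by simp only [Matrix.mul_assoc],
      Matrix.mem_unitaryGroup_iff'.1 u.2, mul_one]
    simp only [Matrix.mul_assoc]
  rw [h1, h2, ← Matrix.smul_mul, ← Matrix.mul_smul, ← add_mul, ← mul_add, h3,
    ← Matrix.diagonal_smul, Matrix.diagonal_add, Matrix.diagonal_mul_diagonal]
  congr 3
  funext p
  by_cases hp : p = q
  · subst hp; simp [hD]
  · simp [hp]

/-- One quasi-reflection is multiplied in for each eigenvector in `t`, and the half-angle phases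
accumulate into the exponential of half the sum. The partial sets `t` serve the induction. -/
lemma exists_map_eq_conj_diagonal {S A : Type*} [Monoid S] [Ring A] [Algebra ℂ A] (π : S →* A)
    (L : Matrix (Fin n) (Fin n) ℂ →* A)
    (H : ∀ v : Fin n → ℂ, ∑ p, Complex.normSq (v p) = 1 → ∀ θ : ℝ, ∃ s : S, π s =
      Complex.exp (θ * Complex.I / 2) •
        L (1 + (Complex.exp (θ * Complex.I) - 1) • Matrix.vecMulVec v (star v)))
    (u : Matrix.unitaryGroup (Fin n) ℂ) (θ : Fin n → ℝ) (t : Finset (Fin n)) :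
    ∃ s : S, π s =
      Complex.exp ((∑ p ∈ t, θ p : ℝ) * Complex.I / 2) • L (u.1 * Matrix.diagonal
        (fun p => if p ∈ t then Complex.exp (θ p * Complex.I) else 1) * star u.1) := by
  induction t using Finset.induction_on with
  | empty =>
    refine ⟨1, ?_⟩
    have h : u.1 * Matrix.diagonal (fun p => if p ∈ (∅ : Finset (Fin n)) then
        Complex.exp (θ p * Complex.I) else 1) * star u.1 = 1 := by
      simp only [Finset.notMem_empty, if_false]
      rw [Matrix.diagonal_one, mul_one, Matrix.mem_unitaryGroup_iff.1 u.2]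
    rw [h, map_one, map_one, Finset.sum_empty, Complex.ofReal_zero, zero_mul, zero_div,
      Complex.exp_zero, one_smul]
  | insert q t hq ih =>
    obtain ⟨s, hs⟩ := ih
    obtain ⟨r, hr⟩ := H _ (unitary_col_normSq u q) (θ q)
    refine ⟨r * s, ?_⟩
    have h1 := conj_diagonal_update u q (Complex.exp (θ q * Complex.I))
      (fun p => if p ∈ t then Complex.exp (θ p * Complex.I) else 1) (if_neg hq)
    have h2 : (fun p => if p ∈ insert q t then Complex.exp (θ p * Complex.I) else 1) =
        Function.update (fun p => if p ∈ t then Complex.exp (θ p * Complex.I) else 1) q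
          (Complex.exp (θ q * Complex.I)) := by
      funext p
      by_cases hp : p = q
      · subst hp; simp
      · simp [hp]
    rw [h2, ← h1, map_mul, map_mul, Finset.sum_insert hq, Complex.ofReal_add, add_mul, add_div,
      Complex.exp_add, ← smul_mul_smul_comm, ← hr, ← hs]

lemma exists_map_eq_of_SU {S A : Type*} [Monoid S] [Ring A] [Algebra ℂ A] (π : S →* A)
    (L : Matrix (Fin n) (Fin n) ℂ →* A)
    (H : ∀ v : Fin n → ℂ, ∑ p, Complex.normSq (v p) = 1 → ∀ θ : ℝ, ∃ s : S, π s =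
      Complex.exp (θ * Complex.I / 2) •
        L (1 + (Complex.exp (θ * Complex.I) - 1) • Matrix.vecMulVec v (star v)))
    (hn : 1 ≤ n) (h : SU n) : ∃ s : S, π s = L h.1 := by
  obtain ⟨u, θ, hθ, hu⟩ := exists_special_unitary_diagonalization hn h
  obtain ⟨s, hs⟩ := exists_map_eq_conj_diagonal π L H u θ Finset.univ
  refine ⟨s, hs.trans ?_⟩
  simp only [Finset.mem_univ, if_true]
  rw [← hu, hθ, Complex.ofReal_zero, zero_mul, zero_div, Complex.exp_zero, one_smul]

/-- The factorization of a homomorphism through an injective one. -/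
lemma exists_factorization {G S A : Type*} [Monoid G] [Monoid S] [Monoid A] {π : S →* A}
    (hπ : Function.Injective π) (L : G →* A) (H : ∀ g, ∃ s, π s = L g) :
    ∃ ρ : G →* S, ∀ g, π (ρ g) = L g := by
  choose ρ hρ using H
  exact ⟨⟨⟨ρ, hπ (by rw [hρ, map_one, map_one])⟩,
    fun g h => hπ (by simp only [map_mul, hρ])⟩, hρ⟩

/-- The restriction of a Clifford module to the spin group. -/
def spinHom {V A : Type*} [AddCommGroup V] [Module ℝ V] {q : QuadraticForm ℝ V} [Ring A]
    [Algebra ℝ A] (π : CliffordAlgebra q →ₐ[ℝ] A) : spinGroup q →* A :=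
  (π : CliffordAlgebra q →* A).comp (spinGroup q).subtype

/-! ### Faithfulness of Clifford modules on the spin group -/

section

variable {V A : Type*} [AddCommGroup V] [Module ℝ V] [FiniteDimensional ℝ V]
  {q : QuadraticForm ℝ V} [Ring A] [Nontrivial A] [Algebra ℝ A] (π : CliffordAlgebra q →ₐ[ℝ] A)

/-- The map `π` itself is not assumed injective. Spin elements are fixed by `involute`, so their
difference falls under faithfulness on the even part. -/
lemma spinHom_injective (hq : Function.Surjective q.polarBilin) :
    Function.Injective (spinHom π) := by
  intro s t h
  have h' : π s = π t := h
  refine Subtype.ext (sub_eq_zero.1 (eq_zero_of_map_eq_zero π hq ?_ ?_))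
  · rw [map_sub, h', sub_self]
  · rw [map_sub, spinGroup.involute_eq s.2, spinGroup.involute_eq t.2, map_sub, h', sub_self]

/-- The difference `s v - w s` is odd, so `involute` only negates it, and the relation seen through
`π` lifts to the Clifford algebra. -/
lemma conj_ι_eq (hq : Function.Surjective q.polarBilin) (s : spinGroup q) (v w : V)
    (h : spinHom π s * π (CliffordAlgebra.ι q v) = π (CliffordAlgebra.ι q w) * spinHom π s) :
    (s : CliffordAlgebra q) * CliffordAlgebra.ι q v * ((s⁻¹ : spinGroup q) : CliffordAlgebra q) =
      CliffordAlgebra.ι q w := by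
  have key : (s : CliffordAlgebra q) * CliffordAlgebra.ι q v = CliffordAlgebra.ι q w * s := by
    have h1 : π (s * CliffordAlgebra.ι q v - CliffordAlgebra.ι q w * s) = 0 := by
      rw [map_sub, map_mul, map_mul, sub_eq_zero]
      exact h
    refine sub_eq_zero.1 (eq_zero_of_map_eq_zero π hq h1 ?_)
    rw [map_sub, map_mul, map_mul, CliffordAlgebra.involute_ι, CliffordAlgebra.involute_ι,
      spinGroup.involute_eq s.2, mul_neg, neg_mul, ← neg_sub', map_neg, h1, neg_zero]
  have h2 : (s : CliffordAlgebra q) * ((s⁻¹ : spinGroup q) : CliffordAlgebra q) = 1 :=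
    spinGroup.coe_mul_star_self _
  rw [key, mul_assoc, h2, mul_one]

/-- If `π` is faithful on the even part, then continuity into the spin group can be tested after
composition with `π`. -/
lemma exists_continuous_leftInverse (hq : Function.Surjective q.polarBilin) [TopologicalSpace A] [IsModuleTopology ℝ A] :
    letI : TopologicalSpace (CliffordAlgebra q) := moduleTopology ℝ _
    ∃ P : A → CliffordAlgebra q, Continuous P ∧ ∀ s : spinGroup q, P (spinHom π s) = s := by
  let _ : TopologicalSpace (CliffordAlgebra q) := moduleTopology ℝ _
  have _ : IsModuleTopology ℝ (CliffordAlgebra q) := ⟨rfl⟩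
  have _ : ContinuousAdd (CliffordAlgebra q) := IsModuleTopology.toContinuousAdd ℝ _
  -- The pair `(π, π ∘ involute)` is injective on the whole algebra, and a linear left inverse is
  -- automatically continuous. On even elements both coordinates agree, so composing with the
  -- diagonal recovers `s` from `π s` alone.
  set T : CliffordAlgebra q →ₗ[ℝ] A × A :=
    π.toLinearMap.prod (π.toLinearMap ∘ₗ CliffordAlgebra.involute.toLinearMap) with hT
  obtain ⟨P, hP⟩ := LinearMap.exists_leftInverse_of_injective T (LinearMap.ker_eq_bot'.2
    fun s hs => eq_zero_of_map_eq_zero π hq (congrArg Prod.fst hs) (congrArg Prod.snd hs))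
  refine ⟨P ∘ₗ LinearMap.prod LinearMap.id LinearMap.id,
    IsModuleTopology.continuous_of_linearMap _, fun s => ?_⟩
  refine Eq.trans ?_ (LinearMap.congr_fun hP (s : CliffordAlgebra q))
  change P (π s, π s) = P (π s, π (CliffordAlgebra.involute (s : CliffordAlgebra q)))
  rw [spinGroup.involute_eq s.2]

end

/-- The action of matrices on `Σ` as a homomorphism of monoids. -/
def ΛHom (hb : 0 < b) : Matrix (Fin n) (Fin n) ℂ →* Module.End ℂ (Spinor n b) where
  toFun := Λ hb
  map_one' := Λ_one hb
  map_mul' := Λ_mul hb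

lemma exists_lift_apply (hn : 1 ≤ n) (ha : 0 < a) (hb : 0 < b) : ∃ ρ : SU n →* Spin n a b,
    ∀ h, cliffordRep hn ha hb (ρ h : CliffordAlgebra (Q n a b)) = Λ hb h.1 :=
  exists_factorization (π := spinHom (cliffordRep hn ha hb))
    (spinHom_injective _ (exists_polarBilin_eq hn ha hb))
    ((ΛHom hb).comp (Submonoid.subtype _))
    (exists_map_eq_of_SU (spinHom (cliffordRep hn ha hb)) (ΛHom hb)
      (fun _ hv θ => exists_spin_quasiReflection hn ha hb hv θ) hn)

lemma covers_of_apply (hn : 1 ≤ n) (ha : 0 < a) (hb : 0 < b) {ρ : SU n →* Spin n a b}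
    (hρ : ∀ h, cliffordRep hn ha hb (ρ h : CliffordAlgebra (Q n a b)) = Λ hb h.1)
    (h : SU n) (X : 𝔪 n) :
    (ρ h : CliffordAlgebra (Q n a b)) * CliffordAlgebra.ι (Q n a b) X *
      (((ρ h)⁻¹ : Spin n a b) : CliffordAlgebra (Q n a b)) =
        CliffordAlgebra.ι (Q n a b) (isotropy n h X) := by
  refine conj_ι_eq (cliffordRep hn ha hb) (exists_polarBilin_eq hn ha hb) (ρ h) _ _ ?_
  exact (congrArg₂ (· * ·) (hρ h) (cliffordRep_ι hn ha hb X)).trans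
    ((Λ_cliffordMul hn a hb h X).trans
      (congrArg₂ (· * ·) (cliffordRep_ι hn ha hb (isotropy n h X)) (hρ h)).symm)

/-- Two lifts of the isotropy representation agree. -/
lemma lift_unique (hn : 1 ≤ n) (ha : 0 < a) (hb : 0 < b) {ρ ρ' : SU n →* Spin n a b}
    (h : IsSpinLift ρ) (h' : IsSpinLift ρ') : ρ = ρ' := by
  refine MonoidHom.ext fun k₀ => ?_
  -- At a square root `k` the lifts agree up to a sign, which disappears on squaring; this takes the
  -- place of a connectedness argument.
  obtain ⟨k, rfl⟩ := exists_sq_eq hn k₀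
  have hinv : ∀ s : Spin n a b, ((s⁻¹ : Spin n a b) : CliffordAlgebra (Q n a b)) * s = 1 :=
    fun s => spinGroup.coe_star_mul_self s
  have hinv' : ∀ s : Spin n a b, (s : CliffordAlgebra (Q n a b)) * (s⁻¹ : Spin n a b) = 1 :=
    fun s => spinGroup.coe_mul_star_self s
  set s : Spin n a b := (ρ' k)⁻¹ * ρ k with hs
  have hcomm : ∀ X, (s : CliffordAlgebra (Q n a b)) * CliffordAlgebra.ι (Q n a b) X =
      CliffordAlgebra.ι (Q n a b) X * s := by
    intro X
    have e1 : (ρ k : CliffordAlgebra (Q n a b)) * CliffordAlgebra.ι (Q n a b) X =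
        CliffordAlgebra.ι (Q n a b) (isotropy n k X) * ρ k := by
      rw [← h.covers k X, mul_assoc, hinv, mul_one]
    have e2 : ((ρ' k)⁻¹ : Spin n a b) * CliffordAlgebra.ι (Q n a b) (isotropy n k X) =
        CliffordAlgebra.ι (Q n a b) X * ((ρ' k)⁻¹ : Spin n a b) := by
      rw [← h'.covers k X, mul_assoc, ← mul_assoc, ← mul_assoc, hinv, one_mul]
    change ((ρ' k)⁻¹ : Spin n a b) * (ρ k : CliffordAlgebra (Q n a b)) * _ =
      _ * (((ρ' k)⁻¹ : Spin n a b) * (ρ k : CliffordAlgebra (Q n a b)))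
    rw [mul_assoc, e1, ← mul_assoc, e2, mul_assoc]
  obtain ⟨r, hr⟩ := exists_algebraMap_of_commute hn ha hb (spinGroup.involute_eq s.2) hcomm
  -- A scalar is its own star, so `s * star s = 1` reads `r² = 1`.
  have hr2 : r * r = 1 := by
    have h1 : (s : CliffordAlgebra (Q n a b)) * star (s : CliffordAlgebra (Q n a b)) = 1 :=
      spinGroup.coe_mul_star_self s
    rw [hr, CliffordAlgebra.star_algebraMap, ← map_mul] at h1
    let _ : Invertible (2 : ℝ) := invertibleOfNonzero two_ne_zero
    exact (algebraMap ℝ (CliffordAlgebra (Q n a b))).injective (h1.trans (map_one _).symm)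
  have hρ : (ρ k : CliffordAlgebra (Q n a b)) = algebraMap ℝ _ r * (ρ' k) := by
    rw [Algebra.commutes, ← hr]
    change _ = (ρ' k : CliffordAlgebra (Q n a b)) *
      (((ρ' k)⁻¹ : Spin n a b) * (ρ k : CliffordAlgebra (Q n a b)))
    rw [← mul_assoc, hinv', one_mul]
  rw [map_mul, map_mul]
  refine Subtype.ext ?_
  change (ρ k : CliffordAlgebra (Q n a b)) * (ρ k : CliffordAlgebra (Q n a b)) = ρ' k * ρ' k
  rw [hρ, mul_assoc, ← mul_assoc (ρ' k : CliffordAlgebra (Q n a b)), ← Algebra.commutes r,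
    mul_assoc, ← mul_assoc, ← map_mul, hr2, map_one, one_mul]

end

/-! ### Exterior algebras of spaces with a basis -/

section Exterior

variable {M : Type*} [AddCommGroup M] [Module ℂ M] {n : ℕ} (e : Module.Basis (Fin n) ℂ M)

lemma exteriorBasis_empty : e.ExteriorAlgebra ∅ = 1 := by
  rw [ExteriorAlgebra.basis_apply_ofCard e (n := 0) Finset.card_empty]
  simp [ExteriorAlgebra.ιMulti_apply]

lemma exteriorBasis_univ : e.ExteriorAlgebra Finset.univ = ExteriorAlgebra.ιMulti ℂ n e := by
  rw [ExteriorAlgebra.basis_apply_ofCard e (Finset.card_fin n)]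
  change ExteriorAlgebra.ιMulti ℂ n (e ∘ Finset.orderEmbOfFin Finset.univ (Finset.card_fin n)) = _
  congr 1
  have h : RelEmbedding.refl (· ≤ ·) = Finset.orderEmbOfFin Finset.univ (Finset.card_fin n) :=
    Finset.orderEmbOfFin_unique' _ fun _ => Finset.mem_univ _
  rw [← h]
  rfl

/-- A diagonal endomorphism acts diagonally on the exterior algebra. -/
lemma map_exteriorBasis {f : M →ₗ[ℂ] M} {c : Fin n → ℂ} (hf : ∀ p, f (e p) = c p • e p)
    (s : Finset (Fin n)) :
    ExteriorAlgebra.map f (e.ExteriorAlgebra s) = (∏ p ∈ s, c p) • e.ExteriorAlgebra s := by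
  rw [ExteriorAlgebra.basis_apply_ofCard e (rfl : s.card = s.card)]
  change ExteriorAlgebra.map f
    (ExteriorAlgebra.ιMulti ℂ s.card (e ∘ Finset.orderEmbOfFin s rfl)) =
      _ • ExteriorAlgebra.ιMulti ℂ s.card (e ∘ Finset.orderEmbOfFin s rfl)
  have h1 : f ∘ e ∘ Finset.orderEmbOfFin s rfl = fun j =>
      c (Finset.orderEmbOfFin s rfl j) • (e ∘ Finset.orderEmbOfFin s rfl) j := by
    funext j
    simp [hf]
  have h2 : ∏ p ∈ s, c p = ∏ j, c (Finset.orderEmbOfFin s rfl j) := by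
    conv_lhs => rw [← Finset.image_orderEmbOfFin_univ s rfl]
    rw [Finset.prod_image fun i _ j _ h => (Finset.orderEmbOfFin s rfl).injective h]
  rw [ExteriorAlgebra.map_apply_ιMulti, h1, h2]
  exact (ExteriorAlgebra.ιMulti ℂ s.card).toMultilinearMap.map_smul_univ _ _

/-- The sign change of the `p`-th and the `q`-th coordinates. -/
def signs (p q : Fin n) : Fin n → ℂ := fun i => if i = p ∨ i = q then -1 else 1

lemma mem_span_of_signs {x : ExteriorAlgebra ℂ M} {f : Fin n → Fin n → M →ₗ[ℂ] M}
    (hf : ∀ p q i, f p q (e i) = signs p q i • e i)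
    (hx : ∀ p q, p ≠ q → ExteriorAlgebra.map (f p q) x = x) :
    x ∈ Submodule.span ℂ {1, ExteriorAlgebra.ιMulti ℂ n e} := by
  set B := e.ExteriorAlgebra
  rw [← B.sum_repr x]
  refine Submodule.sum_mem _ fun s _ => ?_
  by_cases hs0 : s = ∅
  · refine Submodule.smul_mem _ _ (Submodule.subset_span (Or.inl ?_))
    rw [hs0]
    exact exteriorBasis_empty e
  by_cases hs1 : s = Finset.univ
  · refine Submodule.smul_mem _ _ (Submodule.subset_span (Or.inr ?_))
    rw [hs1]
    exact exteriorBasis_univ e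
  obtain ⟨p, hp⟩ := Finset.nonempty_iff_ne_empty.2 hs0
  obtain ⟨q, hq⟩ : ∃ q, q ∉ s := by
    by_contra h
    push Not at h
    exact hs1 (Finset.eq_univ_iff_forall.2 h)
  have hpq : p ≠ q := fun h => hq (h ▸ hp)
  have h1 : B.coord s ∘ₗ (ExteriorAlgebra.map (f p q)).toLinearMap =
      (∏ i ∈ s, signs p q i) • B.coord s := by
    refine B.ext fun t => ?_
    rw [LinearMap.comp_apply, AlgHom.toLinearMap_apply, map_exteriorBasis e (hf p q), map_smul,
      LinearMap.smul_apply, Module.Basis.coord_apply, Module.Basis.repr_self, Finsupp.single_apply]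
    by_cases hts : t = s
    · rw [hts]
    · simp [hts]
  have h2 : ∏ i ∈ s, signs p q i = -1 := by
    rw [Finset.prod_eq_single_of_mem p hp]
    · simp [signs]
    · intro i hi hip
      have : i ≠ q := fun h => hq (h ▸ hi)
      simp [signs, hip, this]
  have h3 := LinearMap.congr_fun h1 x
  rw [LinearMap.comp_apply, AlgHom.toLinearMap_apply, hx p q hpq, h2, LinearMap.smul_apply,
    Module.Basis.coord_apply] at h3
  have h4 : B.repr x s = 0 := by
    rw [neg_one_smul] at h3
    exact self_eq_neg.1 h3
  rw [h4, zero_smul]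
  exact Submodule.zero_mem _

/-- An alternating map in `n` arguments on an `n`-dimensional space is its value on the basis times
`e.det`, and `e.det (f ∘ e) = det f`. -/
lemma map_ιMulti_basis (f : M →ₗ[ℂ] M) :
    ExteriorAlgebra.map f (ExteriorAlgebra.ιMulti ℂ n e) =
      LinearMap.det f • ExteriorAlgebra.ιMulti ℂ n e := by
  have h : ExteriorAlgebra.ιMulti ℂ n (M := M) = (LinearMap.toSpanSingleton ℂ _
      (ExteriorAlgebra.ιMulti ℂ n e)).compAlternatingMap e.det := by
    refine Module.Basis.ext_alternating e fun i hi => ?_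
    let σ : Equiv.Perm (Fin n) := Equiv.ofBijective i (Finite.injective_iff_bijective.1 hi)
    change ExteriorAlgebra.ιMulti ℂ n (e ∘ σ) =
      e.det (e ∘ σ) • ExteriorAlgebra.ιMulti ℂ n e
    simp [AlternatingMap.map_perm, Module.Basis.det_self]
  rw [ExteriorAlgebra.map_apply_ιMulti]
  conv_lhs => rw [h]
  change e.det (f ∘ e) • ExteriorAlgebra.ιMulti ℂ n e = _
  rw [Module.Basis.det_comp, Module.Basis.det_self, mul_one]

lemma linearIndependent_one_top (hn : 1 ≤ n) :
    LinearIndependent ℂ ![1, ExteriorAlgebra.ιMulti ℂ n e] := by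
  have hne : (∅ : Finset (Fin n)) ≠ Finset.univ := by
    intro h
    have := Finset.mem_univ (⟨0, hn⟩ : Fin n)
    rw [← h] at this
    simp at this
  have h := e.ExteriorAlgebra.linearIndependent.comp ![∅, Finset.univ] (by
    intro i j hij
    fin_cases i <;> fin_cases j <;> simp_all)
  have h' : e.ExteriorAlgebra ∘ ![∅, Finset.univ] = ![1, ExteriorAlgebra.ιMulti ℂ n e] := by
    funext i
    fin_cases i
    · exact exteriorBasis_empty e
    · exact exteriorBasis_univ e
  rwa [h'] at h

/-- The action on the exterior algebra depends continuously on the matrix. -/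
lemma continuous_exterior_map {T : Type*} [TopologicalSpace T] {f : T → M →ₗ[ℂ] M}
    {c : T → Matrix (Fin n) (Fin n) ℂ} (hc : Continuous c)
    (hf : ∀ t q, f t (e q) = ∑ p, c t p q • e p) :
    @Continuous T (Module.End ℂ (ExteriorAlgebra ℂ M)) _ (moduleTopology ℝ _)
      fun t => (ExteriorAlgebra.map (f t)).toLinearMap := by
  have hfin : Module.Finite ℂ (ExteriorAlgebra ℂ M) := Module.Finite.of_basis e.ExteriorAlgebra
  let _ : TopologicalSpace (ExteriorAlgebra ℂ M) := moduleTopology ℂ _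
  let _ : TopologicalSpace (Module.End ℂ (ExteriorAlgebra ℂ M)) := moduleTopology ℝ _
  have _ : IsModuleTopology ℂ (ExteriorAlgebra ℂ M) := ⟨rfl⟩
  have _ : IsModuleTopology ℝ (Module.End ℂ (ExteriorAlgebra ℂ M)) := ⟨rfl⟩
  have _ : IsTopologicalRing (ExteriorAlgebra ℂ M) := IsModuleTopology.isTopologicalRing ℂ _
  have _ : IsTopologicalAddGroup (Module.End ℂ (ExteriorAlgebra ℂ M)) :=
    IsModuleTopology.topologicalAddGroup ℝ _
  have hι : ∀ m : M, Continuous fun t => ExteriorAlgebra.ι ℂ (f t m) := by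
    intro m
    have : ∀ t, ExteriorAlgebra.ι ℂ (f t m) =
        ∑ q, ∑ p, (e.repr m q * c t p q) • ExteriorAlgebra.ι ℂ (e p) := by
      intro t
      conv_lhs => rw [← e.sum_repr m]
      simp only [map_sum, map_smul, hf, Finset.smul_sum, smul_smul]
    simp only [this]
    refine continuous_finsetSum _ fun q _ => continuous_finsetSum _ fun p _ => ?_
    have h1 : Continuous fun t => e.repr m q * c t p q :=
      continuous_const.mul (hc.matrix_elem p q)
    have h2 : Continuous fun _ : T => ExteriorAlgebra.ι ℂ (e p) := continuous_const
    exact h1.smul h2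
  -- Pointwise continuity follows by building `η` from vectors, since multiplication is continuous.
  have hη : ∀ η : ExteriorAlgebra ℂ M, Continuous fun t => ExteriorAlgebra.map (f t) η := by
    intro η
    induction η using CliffordAlgebra.left_induction with
    | algebraMap r => simp only [AlgHom.commutes]; exact continuous_const
    | add x y hx hy => simp only [map_add]; exact hx.add hy
    | ι_mul x m hx =>
      simp only [map_mul]
      refine Continuous.mul ?_ hx
      exact (hι m).congr fun t => (ExteriorAlgebra.map_apply_ι (f t) m).symm
  -- Expansion in matrix units reduces continuity in the endomorphism algebra to continuity of the
  -- coordinates of the values on basis elements.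
  have hsum : ∀ φ : Module.End ℂ (ExteriorAlgebra ℂ M), φ = ∑ s, ∑ s',
      e.ExteriorAlgebra.coord s' (φ (e.ExteriorAlgebra s)) •
        (e.ExteriorAlgebra.coord s).smulRight (e.ExteriorAlgebra s') := by
    intro φ
    refine e.ExteriorAlgebra.ext fun s => ?_
    rw [LinearMap.sum_apply, Finset.sum_eq_single s]
    · simp only [LinearMap.sum_apply, LinearMap.smul_apply, LinearMap.smulRight_apply,
        Module.Basis.coord_apply, Module.Basis.repr_self, Finsupp.single_eq_same, one_smul]
      exact (e.ExteriorAlgebra.sum_repr _).symm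
    · intro t _ hts
      simp only [LinearMap.sum_apply, LinearMap.smul_apply, LinearMap.smulRight_apply,
        Module.Basis.coord_apply, Module.Basis.repr_self, Finsupp.single_eq_of_ne hts, zero_smul,
        smul_zero, Finset.sum_const_zero]
    · simp
  refine Continuous.congr ?_ fun t => (hsum _).symm
  refine continuous_finsetSum _ fun s _ => continuous_finsetSum _ fun s' _ => ?_
  refine Continuous.comp (g := fun z : ℂ => z • (e.ExteriorAlgebra.coord s).smulRight
    (e.ExteriorAlgebra s')) ?_
    ((IsModuleTopology.continuous_of_linearMap (e.ExteriorAlgebra.coord s')).comp (hη _))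
  exact LinearMap.continuous_of_finiteDimensional ((LinearMap.toSpanSingleton ℂ _
    ((e.ExteriorAlgebra.coord s).smulRight (e.ExteriorAlgebra s'))).restrictScalars ℝ)

end Exterior

/-! ### Invariant spinors -/

section

variable {n : ℕ} {a b : ℝ}

/-- Continuity holds because `ρ` is the composite of the continuous `h ↦ Λ hb h` with a continuous
left inverse of the spin representation, and `Spin(𝔪)` carries the topology induced from the
Clifford algebra. -/
lemma isSpinLift_of_apply (hn : 1 ≤ n) (ha : 0 < a) (hb : 0 < b) {ρ : SU n →* Spin n a b}
    (hρ : ∀ h, cliffordRep hn ha hb (ρ h : CliffordAlgebra (Q n a b)) = Λ hb h.1) :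
    IsSpinLift ρ := by
  refine ⟨?_, covers_of_apply hn ha hb hρ⟩
  let _ : TopologicalSpace (Module.End ℂ (Spinor n b)) := moduleTopology ℝ _
  have _ : IsModuleTopology ℝ (Module.End ℂ (Spinor n b)) := ⟨rfl⟩
  obtain ⟨P, hP, hPs⟩ := exists_continuous_leftInverse (cliffordRep hn ha hb)
    (exists_polarBilin_eq hn ha hb)
  have hc : Continuous fun h : SU n => h.1.map star := continuous_subtype_val.matrix_map
    continuous_star
  have hΛ : Continuous fun h : SU n => Λ hb h.1 :=
    continuous_exterior_map (yBasis n hb) hc fun h q => cj_yBasis hb h.1 q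
  refine continuous_induced_rng.2 ((hP.comp hΛ).congr fun h => ?_)
  exact (congrArg P (hρ h).symm).trans (hPs (ρ h))

lemma diagonal_signs_mem {p q : Fin n} (hpq : p ≠ q) :
    Matrix.diagonal (signs p q) ∈ Matrix.specialUnitaryGroup (Fin n) ℂ := by
  have hs : ∀ i, star (signs p q i) = signs p q i := fun i => by
    unfold signs; split_ifs <;> simp
  refine Matrix.mem_specialUnitaryGroup_iff.2 ⟨Matrix.mem_unitaryGroup_iff.2 ?_, ?_⟩
  · rw [Matrix.star_eq_conjTranspose, Matrix.diagonal_conjTranspose, Matrix.diagonal_mul_diagonal,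
      ← Matrix.diagonal_one]
    congr 1
    funext i
    rw [Pi.star_apply, hs]
    unfold signs; split_ifs <;> simp
  · rw [Matrix.det_diagonal, Finset.prod_eq_mul p q hpq]
    · simp [signs]
    · intro i _ hi
      simp [signs, hi.1, hi.2]
    · simp
    · simp

lemma cj_diagonal_signs (hb : 0 < b) (p q i : Fin n) :
    cj hb (Matrix.diagonal (signs p q)) (yBasis n hb i) = signs p q i • yBasis n hb i := by
  rw [cj_yBasis, Finset.sum_eq_single i]
  · rw [Matrix.diagonal_apply_eq]
    congr 1
    unfold signs; split_ifs <;> simp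
  · intro j _ hj
    rw [Matrix.diagonal_apply_ne _ hj, star_zero, zero_smul]
  · simp

lemma ψminus_eq (hb : 0 < b) : ψminus n b = ExteriorAlgebra.ιMulti ℂ n (yBasis n hb) :=
  congrArg _ (funext fun p => (yBasis_apply hb p).symm)

/-- The `SU(n)`-invariants of `Σ` are spanned by `ψ₊` and `ψ₋`. -/
lemma forall_Λ_eq_iff (hb : 0 < b) (ψ : Spinor n b) :
    (∀ h : SU n, Λ hb h.1 ψ = ψ) ↔ ψ ∈ Submodule.span ℂ {ψplus n b, ψminus n b} := by
  rw [ψminus_eq hb]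
  constructor
  · intro H
    exact mem_span_of_signs (yBasis n hb) (cj_diagonal_signs hb)
      fun p q hpq => H ⟨_, diagonal_signs_mem hpq⟩
  · intro H h
    -- The determinant of the conjugate matrix is the conjugate of `det h = 1`.
    have hdet : LinearMap.det (cj hb h.1) = 1 := by
      rw [cj, LinearMap.det_toLin]
      have := (starRingEnd ℂ).map_det h.1
      rw [(Matrix.mem_specialUnitaryGroup_iff.1 h.2).2, map_one] at this
      exact this.symm
    have hsub : Submodule.span ℂ {ψplus n b, ExteriorAlgebra.ιMulti ℂ n (yBasis n hb)} ≤
        LinearMap.eqLocus (Λ hb h.1) LinearMap.id := by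
      refine Submodule.span_le.2 ?_
      rintro _ (rfl | rfl)
      · exact map_one (ExteriorAlgebra.map (cj hb h.1))
      · refine (map_ιMulti_basis (yBasis n hb) (cj hb h.1)).trans ?_
        rw [hdet, one_smul]
        rfl
    exact hsub H

lemma mem_invariantSpinors_iff (hn : 1 ≤ n) (ha : 0 < a) (hb : 0 < b) {ρ : SU n →* Spin n a b}
    (hρ : ∀ h, cliffordRep hn ha hb (ρ h : CliffordAlgebra (Q n a b)) = Λ hb h.1)
    (φ : SU (n + 1) → Spinor n b) :
    φ ∈ invariantSpinors hn ha hb ρ ↔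
      ∃ ψ ∈ Submodule.span ℂ {ψplus n b, ψminus n b}, φ = fun _ => ψ := by
  constructor
  · rintro ⟨h1, h2⟩
    -- Translating by `k` itself moves the argument `k` to the identity.
    have hconst : ∀ k, φ k = φ 1 := fun k => by
      rw [← congrFun (h2 k) k, inv_mul_cancel]
    refine ⟨φ 1, (forall_Λ_eq_iff hb _).1 fun h => ?_, funext hconst⟩
    -- Equivariance involves `ρ(h⁻¹)`, so inserting `h⁻¹` produces the action of `h`.
    have h3 := h1 1 h⁻¹
    rw [hconst, inv_inv] at h3
    exact ((LinearMap.congr_fun (hρ h) (φ 1)).symm.trans h3.symm)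
  · rintro ⟨ψ, hψ, rfl⟩
    refine ⟨fun k h => ?_, fun k => rfl⟩
    exact ((LinearMap.congr_fun (hρ h⁻¹) ψ).trans ((forall_Λ_eq_iff hb ψ).2 hψ h⁻¹)).symm

lemma finrank_span_ψ (hn : 1 ≤ n) (hb : 0 < b) :
    Module.finrank ℂ (Submodule.span ℂ {ψplus n b, ψminus n b}) = 2 := by
  rw [ψminus_eq hb]
  have h := finrank_span_eq_card (linearIndependent_one_top (yBasis n hb) hn)
  rw [Matrix.range_cons, Matrix.range_cons, Matrix.range_empty, Set.union_empty,
    Set.singleton_union, Fintype.card_fin] at h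
  exact h

lemma finrank_invariantSpinors (hn : 1 ≤ n) (ha : 0 < a) (hb : 0 < b) {ρ : SU n →* Spin n a b}
    (hρ : ∀ h, cliffordRep hn ha hb (ρ h : CliffordAlgebra (Q n a b)) = Λ hb h.1) :
    Module.finrank ℂ (invariantSpinors hn ha hb ρ) = 2 := by
  let c : Spinor n b →ₗ[ℂ] (SU (n + 1) → Spinor n b) := LinearMap.pi fun _ => LinearMap.id
  have hc : Function.Injective c := fun ψ ψ' h => congrFun h 1
  have hmap : invariantSpinors hn ha hb ρ =
      (Submodule.span ℂ {ψplus n b, ψminus n b}).map c := by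
    refine Submodule.ext fun φ => (mem_invariantSpinors_iff hn ha hb hρ φ).trans ?_
    exact exists_congr fun ψ => and_congr_right fun _ => eq_comm
  rw [hmap, ← finrank_span_ψ hn hb]
  exact (Submodule.equivMapOfInjective c hc _).finrank_eq.symm

end

end HermitianSphere

end

theorem mainTheorem3 (n : ℕ) (hn : 1 ≤ n) (a b : ℝ) (ha : 0 < a) (hb : 0 < b) :
    (∃! ρ : HermitianSphere.SU n →* HermitianSphere.Spin n a b, HermitianSphere.IsSpinLift ρ) ∧
    ∀ ρ : HermitianSphere.SU n →* HermitianSphere.Spin n a b, HermitianSphere.IsSpinLift ρ →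
      (∀ φ : HermitianSphere.SU (n + 1) → HermitianSphere.Spinor n b,
        φ ∈ HermitianSphere.invariantSpinors hn ha hb ρ ↔
          ∃ ψ ∈ Submodule.span ℂ {HermitianSphere.ψplus n b, HermitianSphere.ψminus n b},
            φ = fun _ => ψ) ∧
      Module.finrank ℂ (HermitianSphere.invariantSpinors hn ha hb ρ) = 2 := by
  obtain ⟨ρ₀, hρ₀⟩ := HermitianSphere.exists_lift_apply hn ha hb
  have hlift := HermitianSphere.isSpinLift_of_apply hn ha hb hρ₀
  refine ⟨⟨ρ₀, hlift, fun ρ hρ => HermitianSphere.lift_unique hn ha hb hρ hlift⟩, fun ρ hρ => ?_⟩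
  obtain rfl : ρ = ρ₀ := HermitianSphere.lift_unique hn ha hb hρ hlift
  exact ⟨HermitianSphere.mem_invariantSpinors_iff hn ha hb hρ₀,
    HermitianSphere.finrank_invariantSpinors hn ha hb hρ₀⟩
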